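/- \textbf{Setting.} For $N\ge 1$ put $h=1/(N+1)$, $x_j=jh$ ($j\in\mathbb Z$). A \emph{formula} is a finitely supported sequence $b\in\mathbb C^{(\mathbb Z)}$; it is \emph{symmetric} if $b_j=b_{-j}$, and then $\tau(b)=\max\{j: b_j\neq 0\}$. A pair $(d,s)$ of formulas is consistent of order $n$ if, for all $u\in C^\infty(\mathbb R;\mathbb C)$, $\sum_j d_ju(x_j)+h^2s_ju''(x_j)=O(h^{n+2})$ as $N\to\infty$; $\mathrm{ord}(d,s)$ is the supremum of the even $n$ for which this holds. For $l,m\in\mathbb N$, the \emph{optimal formulas} $(d^{l,m},s^{l,m})$ form the pair that maximizes $\mathrm{ord}(d,s)$ among all pairs $(d,s)\ne(0,0)$ of symmetric formulas with $\tau(d)\le l+1$, $\tau(s)\le m$, normalized by $\sum_j d_jj^2=-2$. For a symmetric formula $d$, $\mathbf D_N(d)\in\mathbb C^{N\times N}$ is the matrix of the convolution $w\mapsto d\star w$ on the space of sequences $w\in\mathbb C^{\mathbb Z}$ that are odd about $0$ and about $N+1$, in the basis $(\mathbf 1_{j+(2N+2)\mathbb Z}-\mathbf 1_{-j+(2N+2)\mathbb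 Z})_{1\le j\le N}$. A sequence $(\mathbf D_N)_{N\ge1}$ of $N\times N$ matrices is \emph{strongly stable} if for all $k\in\mathbb N$ there is $c>0$ such that for all $N\ge 1$ and $\mathbf v\in\mathbb C^N$, $c\|\mathbf v\|_\infty\le\max_{1\le j\le N}\omega_j|(\mathbf D_N\mathbf v)_j|$, where $\omega_j=h^{-2}$ if $k<j<N+1-k$ and $\omega_j=1$ otherwise. Let $(d,s)=(d^{l,m},s^{l,m})$ with $l\ge1$, and $\mu=2(l+m)$. For $1\le i\le l$ let $b^i$ be a symmetric formula with $\tau(b^i)\le\mu/2-1$ such that, with $d^i_j=d_j-d_{2i+j}$ and $s^i_j=s_j+b^i_{i+j}$, one has $\sum_{j>-i}d^i_ju(x_{i+j})+h^2\sum_{j}s^i_ju''(x_{i+j})=O(h^{\mu+2})$ for all $u\in C^\infty(\mathbb R;\mathbb C)$ with $u(0)=0$. The \emph{associated scheme} is $\mathbf D_N(d)\mathbf u^N=h^2\mathbf S_N(f(x_j))_{j\in\mathbb Z}$, where $\mathbf S_N$ is arbitrary for small $N$ and, for $N$ large enough, $(\mathbf S_N\mathbf f)_i$ equals $\sum_js^i_{j-i}\mathbf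 f_j$ if $1\le i\le l$, $\sum_j s^{N+1-i}_{i-j}\mathbf f_j$ if $N+1-l\le i\le N$, and $\sum_js_{j-i}\mathbf f_j$ otherwise. It is \emph{convergent of order $n$} if $\mathbf D_N(d)$ is invertible for all $N\ge1$ and for every $f\in C^\infty(\mathbb R;\mathbb C)$ there is $c>0$ such that, $u$ being the solution of $-u''=f$ on $]0,1[$, $u(0)=u(1)=0$, one has $\max_{1\le j\le N}|\mathbf u^N_j-u(x_j)|\le c\,h^n$ for all $N\ge1$. \textbf{Theorem.} Let $l\ge 1$ and $m\ge 0$. The optimal formulas $(d^{l,m},s^{l,m})$ exist, and for any such formulas: (1) $(\mathbf D_N(d^{l,m}))_{N\ge1}$ is strongly stable; (2) formulas $b^i$, $1\le i\le l$, as above exist, and for any choice of them the associated scheme is convergent of order $2(l+m+1)$. Moreover, (3) let $C(X)=2\sum_{n\ge0}\frac{X^n}{(n+1)^2\binom{2n+2}{n+1}}$; if $(R,Q)\neq(0,0)$ are complex polynomials with $\deg R\le l$, $\deg Q\le m$ and $R=CQ \bmod X^{l+m+1}$ (so that $R$ is, up to a nonzero factor, the Padé numerator $R_{l,m}$), then $R$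 has no zero in $[0,4]$. -/

import Mathlib

open Filter Asymptotics

noncomputable section

namespace CompactFD

/-- The stepsize `h = 1/(N+1)` of the grid with `N` interior points. -/
def step (N : ℕ) : ℝ := 1 / ((N : ℝ) + 1)

/-- The grid point `x_j^N = j h`. -/
def gridPt (N : ℕ) (j : ℤ) : ℝ := (j : ℝ) * step N

/-- Finite difference formulas: finitely supported complex sequences indexed by `ℤ`. -/
abbrev Formula := ℤ →₀ ℂ

/-- Symmetric formulas. -/
def IsSymm (b : Formula) : Prop := ∀ j : ℤ, b j = b (-j)

/-- The stencil size `τ(b) = max {j | b_j ≠ 0}` is at most `k` (this includes `b = 0`). -/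
def StencilLE (b : Formula) (k : ℤ) : Prop := ∀ j : ℤ, k < j → b j = 0

/-- `(d, s)` is consistent of order `n`:
`∑_j d_j u(x_j^N) + h² s_j u''(x_j^N) = O(h^(n+2))` for all smooth `u`, as `N → ∞`. -/
def ConsistentFormula (d s : Formula) (n : ℕ) : Prop :=
  ∀ u : ℝ → ℂ, ContDiff ℝ ((⊤ : ℕ∞) : WithTop ℕ∞) u →
    (fun N : ℕ => (d.sum fun j c => c * u (gridPt N j)) +
      ((step N : ℝ) : ℂ) ^ 2 * (s.sum fun j c => c * iteratedDeriv 2 u (gridPt N j)))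
      =O[atTop] (fun N : ℕ => step N ^ (n + 2))

/-- The exact (even) order of consistency `ord(d, s)`. -/
def ord (d s : Formula) : ℕ∞ :=
  ⨆ (n : ℕ) (_ : Even n ∧ ConsistentFormula d s n), (n : ℕ∞)

/-- Admissible competitors: nonzero pairs of symmetric formulas with
`τ(d) ≤ l + 1` and `τ(s) ≤ m`. -/
structure Admissible (l m : ℕ) (d s : Formula) : Prop where
  symm_d : IsSymm d
  symm_s : IsSymm s
  ne_zero : (d, s) ≠ (0, 0)
  stencil_d : StencilLE d ((l : ℤ) + 1)
  stencil_s : StencilLE s (m : ℤ)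

/-- `(d, s)` is the pair of optimal formulas `(d^{l,m}, s^{l,m})`: it maximizes the order of
consistency among all admissible pairs, and is normalized by `∑_j d_j j² = -2`. -/
structure IsOptimal (l m : ℕ) (d s : Formula) : Prop where
  admissible : Admissible l m d s
  normalized : (d.sum fun j c => c * (j : ℂ) ^ 2) = -2
  maximal : ∀ d' s' : Formula, Admissible l m d' s' → ord d' s' ≤ ord d s

/-- The sequence `1_{j + (2N+2)ℤ} - 1_{-j + (2N+2)ℤ}`. For `j = 1, …, N` these form the canonical
basis of the space of sequences on `ℤ` that are odd about `0` and about `N + 1`; the coordinates of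
such a sequence in this basis are its values at `1, …, N`. -/
def oddPeriodicBasis (N : ℕ) (j : ℤ) : ℤ → ℂ := fun i =>
  (if (2 * (N : ℤ) + 2) ∣ i - j then 1 else 0) - (if (2 * (N : ℤ) + 2) ∣ i + j then 1 else 0)

/-- The convolution `(d ⋆ w)_i = ∑_k d_k w_{i-k}`. -/
def conv (d : Formula) (w : ℤ → ℂ) : ℤ → ℂ := fun i => d.sum fun k c => c * w (i - k)

/-- Row and column `i : Fin N` correspond to the index `i + 1 ∈ {1, …, N}`. -/
def idx {N : ℕ} (i : Fin N) : ℕ := (i : ℕ) + 1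

/-- The matrix `D_N(d)` of the convolution by `d` on the sequences that are odd about `0` and about
`N + 1`, in the canonical basis. -/
def DMat (d : Formula) (N : ℕ) : Matrix (Fin N) (Fin N) ℂ :=
  Matrix.of fun i j => conv d (oddPeriodicBasis N (idx j)) (idx i)

/-- Strong stability of a sequence of square matrices of size `N`, `N ≥ 1`. The norm on
`Fin N → ℂ` is the supremum norm. -/
def StronglyStable (D : (N : ℕ) → Matrix (Fin N) (Fin N) ℂ) : Prop :=
  ∀ l : ℕ, ∃ c : ℝ, 0 < c ∧ ∀ N : ℕ, 1 ≤ N → ∀ v : Fin N → ℂ,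
    c * ‖v‖ ≤ ⨆ j : Fin N,
      if l < idx j ∧ idx j + l < N + 1 then (step N)⁻¹ ^ 2 * ‖((D N).mulVec v) j‖
      else ‖((D N).mulVec v) j‖

/-- `u` solves `-u'' = f` on `]0,1[`, `u(0) = u(1) = 0`. -/
structure IsDirichletSolution (f u : ℝ → ℂ) : Prop where
  continuousOn : ContinuousOn u (Set.Icc 0 1)
  hasDeriv : ∃ v : ℝ → ℂ, ∀ x ∈ Set.Ioo (0 : ℝ) 1,
    HasDerivAt u (v x) x ∧ HasDerivAt v (-f x) x
  left : u 0 = 0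
  right : u 1 = 0

/-- Matrices `S_N` from `ℂ^ℤ` to `ℂ^N` with finitely many nonzero columns, given by their rows. -/
abbrev SMatrix (N : ℕ) := Fin N → Formula

/-- The product `S_N f`. -/
def SMatrix.app {N : ℕ} (S : SMatrix N) (F : ℤ → ℂ) : Fin N → ℂ :=
  fun i => (S i).sum fun j c => c * F j

/-- The scheme `(D_N u^N = h² S_N f^{N,ex})_{N ≥ 1}` is convergent of order `n`. -/
def ConvergentOfOrder (D : (N : ℕ) → Matrix (Fin N) (Fin N) ℂ) (S : (N : ℕ) → SMatrix N)
    (n : ℕ) : Prop :=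
  (∀ N : ℕ, 1 ≤ N → IsUnit (D N)) ∧
  ∀ f : ℝ → ℂ, ContDiff ℝ ((⊤ : ℕ∞) : WithTop ℕ∞) f →
    ∃ c : ℝ, 0 < c ∧ ∀ u : ℝ → ℂ, IsDirichletSolution f u →
      ∀ N : ℕ, 1 ≤ N → ∀ uN : Fin N → ℂ,
        (D N).mulVec uN = ((step N : ℝ) : ℂ) ^ 2 • (S N).app (fun j => f (gridPt N j)) →
        ∀ j : Fin N, ‖uN j - u (gridPt N (idx j))‖ ≤ c * step N ^ n

/-- The boundary formula `d^i_j = d_j - d_{2i+j}`. -/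
def boundaryD (d : Formula) (i : ℕ) : Formula :=
  d - d.equivMapDomain (Equiv.subRight (2 * (i : ℤ)))

/-- The boundary formula `s^i_j = s_j + b_{i+j}`. -/
def boundaryS (s b : Formula) (i : ℕ) : Formula :=
  s + b.equivMapDomain (Equiv.subRight (i : ℤ))

/-- `(d^i, s^i)` is consistent of order `μ` at a distance `i` of the boundary:
`∑_{j > -i} d^i_j u(x_{j+i}^N) + h² ∑_j s^i_j u''(x_{j+i}^N) = O(h^(μ+2))` for all smooth `u` with
`u(0) = 0`. -/
def ConsistentAtBoundary (di si : Formula) (i μ : ℕ) : Prop :=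
  ∀ u : ℝ → ℂ, ContDiff ℝ ((⊤ : ℕ∞) : WithTop ℕ∞) u → u 0 = 0 →
    (fun N : ℕ =>
      ((di.filter fun j => -(i : ℤ) < j).sum fun j c => c * u (gridPt N (j + i))) +
      ((step N : ℝ) : ℂ) ^ 2 * (si.sum fun j c => c * iteratedDeriv 2 u (gridPt N (j + i))))
      =O[atTop] (fun N : ℕ => step N ^ (μ + 2))

/-- `b` is the correction `b^i` of the formula `s` at a distance `i` of the boundary: the symmetric
formula with `τ(b) ≤ μ/2 - 1` that makes `(d^i, s^i)` consistent of order `μ` there. -/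
structure IsBoundaryCorrection (d s : Formula) (μ i : ℕ) (b : Formula) : Prop where
  symm : IsSymm b
  stencil : StencilLE b (((μ / 2 : ℕ) : ℤ) - 1)
  consistent : ConsistentAtBoundary (boundaryD d i) (boundaryS s b i) i μ

/-- The matrix `S_N`: row `i` is `s` translated to `i`, except that the rows `i = 1, …, l` use the
boundary formulas `s^i` and the rows `i = N + 1 - l, …, N` use them symmetrically. -/
def SMat (l : ℕ) (s : Formula) (b : ℕ → Formula) (N : ℕ) : SMatrix N := fun i =>
  if idx i ≤ l then
    (boundaryS s (b (idx i)) (idx i)).equivMapDomain (Equiv.addRight (idx i : ℤ))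
  else if N + 1 ≤ idx i + l then
    (boundaryS s (b (N + 1 - idx i)) (N + 1 - idx i)).equivMapDomain (Equiv.subLeft (idx i : ℤ))
  else s.equivMapDomain (Equiv.addRight (idx i : ℤ))

/-- The power series `C(X) = 4 (arcsin(√X / 2) / √X)² = 2 ∑_n X^n / ((n+1)² binom(2n+2, n+1))`. -/
def CSeries : PowerSeries ℂ :=
  PowerSeries.mk fun n => 2 / (((n : ℂ) + 1) ^ 2 * ((Nat.choose (2 * n + 2) (n + 1) : ℕ) : ℂ))

/-- `(R, Q)` is a Padé pair of type `[l/m]` for `C`: a nonzero solution of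
`R = C Q mod X^(l+m+1)`, `deg R ≤ l`, `deg Q ≤ m`. -/
structure IsPadePair (l m : ℕ) (R Q : Polynomial ℂ) : Prop where
  ne_zero : (R, Q) ≠ (0, 0)
  deg_num : R.natDegree ≤ l
  deg_den : Q.natDegree ≤ m
  approx : (PowerSeries.X : PowerSeries ℂ) ^ (l + m + 1) ∣
    (R : PowerSeries ℂ) - CSeries * (Q : PowerSeries ℂ)

end CompactFD

end

/-! ### Zeros of Padé numerators of Stieltjes series -/

section Pade

open Polynomial

/-! Every symmetric formula is a polynomial in Δ = (-1, 2, -1), whose symbol is δ = 2 - exp(t) -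
exp(-t). Since -t² = δ C(δ), a pair d = D(Δ), s = Q(Δ) is consistent of order 2n exactly when D = X
C Q mod X^(n+1) (`X_pow_dvd_symb_iff`). This forces D = X R, and order 2(l+m+1) says that (R, Q) is
a Padé pair of type [l/m]. Linear algebra provides such a pair. None does better, since excess order
would make (X R, X Q) a Padé pair of type [l+1/m+1] whose numerator vanishes at 0. So optimality and
stability both rest on R having no zero in [0, 4].

That is `pade_numerator_eq_zero`. The series C has the moments of a positive measure on [0, 1/4].
Vanishing coefficients then become orthogonality relations for reversed polynomials, and a zero x of
R in ]0, 4] becomes a point ρ = 1/x ≥ 1/4, which is not interior to the interval of the measure. If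
l ≤ m, one passes to 1/C = 1 - X D, where D has the same positivity and the reversed R is orthogonal
for D, so that it cannot vanish at ρ. If m ≤ l, dividing R by X - x replaces C by C / (1 - ρ X); its
functional is not positive, but a suitable test polynomial still gives a sum of two nonnegative
terms equal to zero.

For stability, D_N(d) acts on odd periodic sequences as Δ R(Δ). The roots r of R avoid [0, 4], so
each Δ - r splits into two factors 1 - a E and 1 - a E⁻¹ with E a shift and |a| < 1; this gives a
lower bound for R(Δ) that does not depend on N (`aeval_seqDelta_bound`). For Δ itself, the discrete
maximum principle with a barrier of unit curvature near both ends gives strong stability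
(`stronglyStable_ofPoly`).

For convergence, the formula d^i is d applied to the odd extension of u. Odd order conditions are
therefore inherited, the zeroth is harmless as u(0) = 0, and the even ones are solved for b^i by a
Vandermonde system. Local errors h^(μ+4) inside and h^(μ+2) near the ends are exactly what strong
stability turns into a global error h^(μ+2). -/

/-- The generating series of the moments of a linear functional on polynomials. -/
noncomputable def momentSeries (L : ℝ[X] →ₗ[ℝ] ℝ) : PowerSeries ℝ :=
  PowerSeries.mk fun n => L (X ^ n)

/-- The functional with prescribed moments. -/
noncomputable def momentFunctional (a : ℕ → ℝ) : ℝ[X] →ₗ[ℝ] ℝ :=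
  Polynomial.lsum fun n => a n • (LinearMap.id : ℝ →ₗ[ℝ] ℝ)

lemma momentFunctional_X_pow (a : ℕ → ℝ) (n : ℕ) : momentFunctional a (X ^ n) = a n := by
  rw [momentFunctional, Polynomial.lsum_apply, X_pow_eq_monomial, sum_monomial_index _ _ (by simp)]
  simp

lemma linearMap_C_mul (L : ℝ[X] →ₗ[ℝ] ℝ) (a : ℝ) (p : ℝ[X]) : L (C a * p) = a * L p := by
  rw [← smul_eq_C_mul, map_smul, smul_eq_mul]

lemma linearMap_polynomial_ext {L M : ℝ[X] →ₗ[ℝ] ℝ} (h : ∀ n : ℕ, L (X ^ n) = M (X ^ n)) :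
    L = M := by
  refine Polynomial.lhom_ext' fun n => LinearMap.ext_ring ?_
  simpa [← X_pow_eq_monomial] using h n

/-- Reversal turns convolution into pairing. This is the bridge from the vanishing coefficients of a
Padé relation to orthogonality of the reversed polynomial. -/
lemma coeff_momentSeries_mul (L : ℝ[X] →ₗ[ℝ] ℝ) (k t : ℕ) (P : ℝ[X]) (hP : P.natDegree ≤ k) :
    PowerSeries.coeff (k + t) (momentSeries L * (P : PowerSeries ℝ)) =
      L (X ^ t * reflect k P) := by
  refine Polynomial.induction_with_natDegree_le (fun P => PowerSeries.coeff (k + t)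
    (momentSeries L * (P : PowerSeries ℝ)) = L (X ^ t * reflect k P)) k (by simp)
    (fun i a _ hi => ?_) (fun f g hfg hg hf hg' => ?_) P hP
  · rw [reflect_C_mul_X_pow, revAt_le hi, mul_left_comm, linearMap_C_mul, ← pow_add,
      Polynomial.coe_mul, Polynomial.coe_pow, Polynomial.coe_C, Polynomial.coe_X,
      mul_left_comm, PowerSeries.coeff_C_mul,
      show k + t = (t + (k - i)) + i by omega, PowerSeries.coeff_mul_X_pow]
    simp [momentSeries]
  · rw [Polynomial.coe_add, mul_add, map_add, hf, hg', reflect_add, mul_add,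
      map_add]

lemma orthogonal_of_moments (L : ℝ[X] →ₗ[ℝ] ℝ) (e n : ℕ) (F : ℝ[X])
    (h : ∀ t < n, L (X ^ (e + t) * F) = 0) (p : ℝ[X]) (hp : p.degree < n) :
    L (X ^ e * (F * p)) = 0 := by
  have hp' : p = ∑ i ∈ Finset.range n, C (p.coeff i) * X ^ i := by
    ext j
    simp only [finsetSum_coeff, coeff_C_mul_X_pow]
    rw [Finset.sum_ite_eq]
    split_ifs with hj
    · rfl
    · rw [Finset.mem_range, not_lt] at hj
      exact coeff_eq_zero_of_degree_lt (hp.trans_le (by exact_mod_cast hj))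
  rw [hp', Finset.mul_sum, Finset.mul_sum, map_sum]
  refine Finset.sum_eq_zero fun i hi => ?_
  have := h i (Finset.mem_range.1 hi)
  rw [show X ^ e * (F * (C (p.coeff i) * X ^ i)) = C (p.coeff i) * (X ^ (e + i) * F) by ring,
    linearMap_C_mul, this, mul_zero]

/-- Strict positivity of a functional and of its products with `X ^ k` and `ρ - X` on squares. -/
structure StieltjesPos (L : ℝ[X] →ₗ[ℝ] ℝ) (ρ : ℝ) : Prop where
  sq : ∀ (k : ℕ) (p : ℝ[X]), p ≠ 0 → 0 < L (X ^ k * p ^ 2)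
  sub : ∀ (k : ℕ) (p : ℝ[X]), p ≠ 0 → 0 < L (X ^ k * ((C ρ - X) * p ^ 2))

/-- The classical argument that orthogonal polynomials have full degree and no zero off the support.
A polynomial `F` of degree below `n` may be tested against itself; if `F = (X - ρ) p`, testing
against `p` contradicts the positivity of `(ρ - X) p²`. -/
lemma eq_zero_of_orthogonal {L : ℝ[X] →ₗ[ℝ] ℝ} {ρ : ℝ} (hL : StieltjesPos L ρ) (e n : ℕ)
    (F : ℝ[X]) (hF : F.natDegree ≤ n) (h : ∀ t < n, L (X ^ (e + t) * F) = 0)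
    (h0 : F.degree < n ∨ F.eval ρ = 0) : F = 0 := by
  rcases h0 with h0 | h0
  · by_contra hne
    have := orthogonal_of_moments L e n F h F h0
    rw [← pow_two] at this
    exact (hL.sq e F hne).ne' this
  · obtain ⟨p, hp⟩ := dvd_iff_isRoot.2 h0
    by_contra hne
    have hp0 : p ≠ 0 := by rintro rfl; exact hne (by simpa using hp)
    have hdeg : p.degree < n := by
      have h1 : F.natDegree = 1 + p.natDegree := by
        rw [hp, natDegree_mul (X_sub_C_ne_zero ρ) hp0, natDegree_X_sub_C]
      rw [degree_eq_natDegree hp0]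
      exact_mod_cast (by omega : p.natDegree < n)
    have h2 := orthogonal_of_moments L e n F h p hdeg
    have h3 := hL.sub e p hp0
    rw [show X ^ e * ((C ρ - X) * p ^ 2) = -(X ^ e * (F * p)) by rw [hp]; ring, map_neg, h2] at h3
    simp at h3

lemma degree_reflect_lt {k : ℕ} {P : ℝ[X]} (hP : P.natDegree ≤ k) (h0 : P.coeff 0 = 0) :
    (reflect k P).degree < k := by
  rw [degree_lt_iff_coeff_zero]
  intro j hj
  rw [coeff_reflect]
  rcases hj.eq_or_lt with rfl | hj
  · rw [revAt_le le_rfl]; simpa using h0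
  · rw [revAt_eq_self_of_lt hj]
    exact coeff_eq_zero_of_natDegree_lt (by omega)

lemma natDegree_reflect_le' {k : ℕ} {P : ℝ[X]} (hP : P.natDegree ≤ k) :
    (reflect k P).natDegree ≤ k := by
  rw [natDegree_le_iff_coeff_eq_zero]
  intro j hj
  rw [coeff_reflect, revAt_eq_self_of_lt hj]
  exact coeff_eq_zero_of_natDegree_lt (by omega)

lemma eval_reflect_eq_zero {k : ℕ} {P : ℝ[X]} (hP : P.natDegree ≤ k) {x : ℝ} (hx : x ≠ 0)
    (h : P.eval x = 0) : (reflect k P).eval x⁻¹ = 0 := by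
  let _ := invertibleOfNonzero hx
  have := (eval₂_reflect_eq_zero_iff (RingHom.id ℝ) x k P hP).2 (by simpa [eval₂_id] using h)
  simpa [eval₂_id] using this

/-! ### The functional of the inverse series -/

section Inverse

variable (L : ℝ[X] →ₗ[ℝ] ℝ)

/-- The operator `f ↦ X f - L(X f)`. -/
noncomputable def compress : Module.End ℝ ℝ[X] where
  toFun f := X * f - C (L (X * f))
  map_add' f g := by simp only [mul_add, map_add]; ring
  map_smul' a f := by
    rw [mul_smul_comm, map_smul, smul_eq_mul, map_mul, RingHom.id_apply, smul_sub,
      smul_eq_C_mul, smul_eq_C_mul]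

lemma compress_apply (f : ℝ[X]) : compress L f = X * f - C (L (X * f)) := rfl

/-- The functional whose moment series `D` satisfies `(1 - X D) C = 1`, if `C` is the moment series
of `L`. -/
noncomputable def inverseFunctional : ℝ[X] →ₗ[ℝ] ℝ :=
  L ∘ₗ LinearMap.mulLeft ℝ X ∘ₗ (LinearMap.applyₗ (1 : ℝ[X])) ∘ₗ
    (aeval (compress L)).toLinearMap

lemma inverseFunctional_apply (f : ℝ[X]) :
    inverseFunctional L f = L (X * (aeval (compress L) f) 1) := by
  simp [inverseFunctional]

/-- Both sides equal L(X²fg) - L(Xf) L(Xg). Symmetry for the form (f, g) ↦ L(Xfg) is what makes the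
inverse functional computable on squares. -/
lemma compress_symm (f g : ℝ[X]) :
    L (X * (compress L f * g)) = L (X * (f * compress L g)) := by
  simp only [compress_apply]
  rw [show X * ((X * f - C (L (X * f))) * g) = X * X * f * g - C (L (X * f)) * (X * g) by ring,
    show X * (f * (X * g - C (L (X * g)))) = X * X * f * g - C (L (X * g)) * (X * f) by ring,
    map_sub, map_sub, linearMap_C_mul, linearMap_C_mul, mul_comm (L (X * f))]

lemma aeval_compress_symm (p f g : ℝ[X]) :
    L (X * (aeval (compress L) p f * g)) = L (X * (f * aeval (compress L) p g)) := by
  induction p using Polynomial.induction_on' generalizing f g with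
  | add p q hp hq =>
    simp only [map_add, LinearMap.add_apply, add_mul, mul_add, hp, hq]
  | monomial n a =>
    rw [← C_mul_X_pow_eq_monomial]
    simp only [map_mul, aeval_C, map_pow, aeval_X, Module.End.mul_apply,
      Module.algebraMap_end_apply]
    rw [smul_mul_assoc, mul_smul_comm, mul_smul_comm, mul_smul_comm, map_smul, map_smul]
    congr 1
    induction n generalizing f g with
    | zero => simp
    | succ n ih =>
      rw [pow_succ, Module.End.mul_apply, ih, compress_symm,
        ← Module.End.mul_apply, (Commute.self_pow (compress L) n).eq]

lemma inverseFunctional_mul (f g : ℝ[X]) : inverseFunctional L (f * g) =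
    L (X * (aeval (compress L) f 1 * aeval (compress L) g 1)) := by
  rw [inverseFunctional_apply, aeval_compress_symm, one_mul, map_mul (aeval (compress L)),
    Module.End.mul_apply]

lemma natDegree_compress_pow (n : ℕ) :
    ((compress L ^ n) 1).natDegree ≤ n ∧ ((compress L ^ n) 1).coeff n = 1 := by
  induction n with
  | zero => simp
  | succ n ih =>
    rw [pow_succ', Module.End.mul_apply, compress_apply]
    constructor
    · refine (natDegree_sub_le _ _).trans (max_le ?_ (by simp))
      exact natDegree_mul_le.trans (by rw [natDegree_X]; omega)
    · rw [coeff_sub, coeff_X_mul, coeff_C_succ, ih.2, sub_zero]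

/-- The n-th iterate of `compress L` on 1 is monic of degree n, so the leading coefficient of `p`
survives. -/
lemma aeval_compress_one_ne_zero {p : ℝ[X]} (hp : p ≠ 0) : aeval (compress L) p 1 ≠ 0 := by
  intro h
  have h1 : (aeval (compress L) p 1).coeff p.natDegree = p.leadingCoeff := by
    rw [aeval_eq_sum_range, LinearMap.sum_apply, finsetSum_coeff, Finset.sum_range_succ,
      Finset.sum_eq_zero]
    · simp [(natDegree_compress_pow L p.natDegree).2]
    · intro i hi
      rw [LinearMap.smul_apply, coeff_smul, coeff_eq_zero_of_natDegree_lt (n := p.natDegree), smul_zero]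
      exact (natDegree_compress_pow L i).1.trans_lt (Finset.mem_range.1 hi)
  rw [h, coeff_zero] at h1
  exact hp (leadingCoeff_eq_zero.1 h1.symm)

lemma compress_ne_zero {f : ℝ[X]} (hf : f ≠ 0) : compress L f ≠ 0 := by
  intro h
  rw [compress_apply, sub_eq_zero] at h
  have := congrArg natDegree h
  rw [natDegree_X_mul hf, natDegree_C] at this
  omega

/-- Unrolling X f = `compress L f` + L(X f) from f = 1 expands Xⁿ in the iterates of `compress L` on
1, with moments of L as coefficients. Applying f ↦ L(X f) gives c_(n+1) = Σ d_i c_j over i + j = n,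
which is the identity of series. -/
lemma momentSeries_inverseFunctional (h1 : L 1 = 1) :
    (1 - PowerSeries.X * momentSeries (inverseFunctional L)) * momentSeries L = 1 := by
  have key : ∀ n : ℕ, (X : ℝ[X]) ^ n = ∑ ij ∈ Finset.HasAntidiagonal.antidiagonal n,
      L (X ^ ij.2) • (compress L ^ ij.1) 1 := by
    intro n
    induction n with
    | zero => simp [h1]
    | succ n ih =>
      have h2 : ∀ f : ℝ[X], X * f = compress L f + C (L (X * f)) := fun f => by
        rw [compress_apply]; ring
      rw [pow_succ', h2, ← pow_succ', Finset.Nat.sum_antidiagonal_succ]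
      simp only [pow_zero, Module.End.one_apply]
      conv_lhs => rw [ih]
      rw [map_sum, smul_eq_C_mul, mul_one, add_comm]
      congr 1
      refine Finset.sum_congr rfl fun ij _ => ?_
      rw [map_smul, pow_succ', Module.End.mul_apply]
  rw [sub_mul, one_mul, mul_assoc, sub_eq_iff_eq_add]
  ext n
  cases n with
  | zero => simp [momentSeries, h1]
  | succ n =>
    rw [map_add, PowerSeries.coeff_one, if_neg (by omega), zero_add, mul_comm PowerSeries.X,
      PowerSeries.coeff_succ_mul_X, PowerSeries.coeff_mul]
    simp only [momentSeries, PowerSeries.coeff_mk]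
    rw [pow_succ', key n, Finset.mul_sum, map_sum]
    refine Finset.sum_congr rfl fun ij _ => ?_
    rw [mul_smul_comm, map_smul, inverseFunctional_apply, smul_eq_mul, mul_comm]
    simp

end Inverse

/-- Strict positivity of a functional on the polynomials that are nonnegative on `[0, 1/4]`. -/
def StrictlyPositive (L : ℝ[X] →ₗ[ℝ] ℝ) : Prop :=
  ∀ p : ℝ[X], p ≠ 0 → (∀ y ∈ Set.Icc (0 : ℝ) (1 / 4), 0 ≤ p.eval y) → 0 < L p

lemma C_sub_X_ne_zero (ρ : ℝ) : (C ρ - X : ℝ[X]) ≠ 0 := by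
  rw [← neg_sub]; exact neg_ne_zero.2 (X_sub_C_ne_zero ρ)

lemma StrictlyPositive.stieltjesPos {L : ℝ[X] →ₗ[ℝ] ℝ} (hL : StrictlyPositive L) {ρ : ℝ}
    (hρ : 1 / 4 ≤ ρ) : StieltjesPos L ρ where
  sq k p hp := by
    refine hL _ (mul_ne_zero (pow_ne_zero _ X_ne_zero) (pow_ne_zero _ hp)) fun y hy => ?_
    have := hy.1
    simp only [eval_mul, eval_pow, eval_X]
    positivity
  sub k p hp := by
    refine hL _ (mul_ne_zero (pow_ne_zero _ X_ne_zero)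
      (mul_ne_zero (C_sub_X_ne_zero ρ) (pow_ne_zero _ hp))) fun y hy => ?_
    have h1 := hy.1
    have h2 : 0 ≤ ρ - y := sub_nonneg.2 (hy.2.trans hρ)
    simp only [eval_mul, eval_pow, eval_X, eval_sub, eval_C]
    positivity

lemma inverseFunctional_sq (L : ℝ[X] →ₗ[ℝ] ℝ) (p : ℝ[X]) :
    inverseFunctional L (p ^ 2) = L (X * (aeval (compress L) p 1) ^ 2) := by
  rw [pow_two, inverseFunctional_mul, pow_two]

/-- With F = p(`compress L`) 1, both sides are the variance L((XF)²) - L(XF)²; this is where the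
normalization `L 1 = 1` enters. -/
lemma inverseFunctional_X_mul_sq {L : ℝ[X] →ₗ[ℝ] ℝ} (h1 : L 1 = 1) (p : ℝ[X]) :
    inverseFunctional L (X * p ^ 2) = L ((compress L (aeval (compress L) p 1)) ^ 2) := by
  rw [pow_two, ← mul_assoc, inverseFunctional_mul, map_mul (aeval (compress L)), aeval_X,
    Module.End.mul_apply]
  set F := aeval (compress L) p 1
  rw [compress_apply]
  rw [show X * ((X * F - C (L (X * F))) * F) = (X * F) ^ 2 - C (L (X * F)) * (X * F) by ring,
    show (X * F - C (L (X * F))) ^ 2 = (X * F) ^ 2 - C (2 * L (X * F)) * (X * F)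
      + C (L (X * F) ^ 2) * 1 by rw [C_mul, C_pow, show C (2 : ℝ) = 2 from rfl]; ring,
    map_add, map_sub, map_sub, linearMap_C_mul, linearMap_C_mul, linearMap_C_mul, h1]
  ring

/-- Even powers of X are absorbed into the square, which leaves the weights 1, X, ρ - X and X(ρ -
X). Each becomes L of a square with weight X, 1, X(ρ - X) or ρ - X respectively, plus the square
L(XF)² in the third case. -/
lemma StrictlyPositive.stieltjesPos_inverse {L : ℝ[X] →ₗ[ℝ] ℝ} (hL : StrictlyPositive L)
    (h1 : L 1 = 1) {ρ : ℝ} (hρ : 1 / 4 ≤ ρ) : StieltjesPos (inverseFunctional L) ρ := by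
  have hS := hL.stieltjesPos hρ
  have hsub0 : ∀ p : ℝ[X], p ≠ 0 → 0 < inverseFunctional L ((C ρ - X) * p ^ 2) := by
    intro p hp
    have hF := aeval_compress_one_ne_zero L hp
    set F := aeval (compress L) p 1 with hFdef
    have : inverseFunctional L ((C ρ - X) * p ^ 2) =
        L (X ^ 1 * ((C ρ - X) * F ^ 2)) + L (X * F) ^ 2 := by
      rw [pow_two, ← mul_assoc, inverseFunctional_mul, map_mul (aeval (compress L)), map_sub,
        aeval_X, aeval_C, Module.End.mul_apply, LinearMap.sub_apply, Module.algebraMap_end_apply,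
        ← hFdef, compress_apply, smul_eq_C_mul,
        show X * ((C ρ * F - (X * F - C (L (X * F)))) * F) =
          X ^ 1 * ((C ρ - X) * F ^ 2) + C (L (X * F)) * (X * F) by ring, map_add, linearMap_C_mul]
      ring
    rw [this]
    have := hS.sub 1 F hF
    positivity
  have hsub1 : ∀ p : ℝ[X], p ≠ 0 → 0 < inverseFunctional L (X * ((C ρ - X) * p ^ 2)) := by
    intro p hp
    have hF := compress_ne_zero L (aeval_compress_one_ne_zero L hp)
    have h2 : inverseFunctional L (X * ((C ρ - X) * p ^ 2)) =
        L (X ^ 0 * ((C ρ - X) * (compress L (aeval (compress L) p 1)) ^ 2)) := by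
      rw [show X * ((C ρ - X) * p ^ 2) = C ρ * (X * p ^ 2) - (X * p) ^ 2 by ring, map_sub,
        linearMap_C_mul, inverseFunctional_X_mul_sq h1, inverseFunctional_sq,
        map_mul (aeval (compress L)), aeval_X, Module.End.mul_apply, pow_zero, one_mul, sub_mul,
        map_sub, linearMap_C_mul]
    rw [h2]
    exact hS.sub 0 _ hF
  constructor
  · intro k p hp
    rcases Nat.even_or_odd' k with ⟨a, rfl | rfl⟩
    · have hp' : X ^ a * p ≠ 0 := mul_ne_zero (pow_ne_zero _ X_ne_zero) hp
      rw [show X ^ (2 * a) * p ^ 2 = (X ^ a * p) ^ 2 by ring, inverseFunctional_sq]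
      simpa using hS.sq 1 _ (aeval_compress_one_ne_zero L hp')
    · have hp' : X ^ a * p ≠ 0 := mul_ne_zero (pow_ne_zero _ X_ne_zero) hp
      rw [show X ^ (2 * a + 1) * p ^ 2 = X * (X ^ a * p) ^ 2 by ring,
        inverseFunctional_X_mul_sq h1]
      simpa using hS.sq 0 _ (compress_ne_zero L (aeval_compress_one_ne_zero L hp'))
  · intro k p hp
    rcases Nat.even_or_odd' k with ⟨a, rfl | rfl⟩
    · have hp' : X ^ a * p ≠ 0 := mul_ne_zero (pow_ne_zero _ X_ne_zero) hp
      rw [show X ^ (2 * a) * ((C ρ - X) * p ^ 2) = (C ρ - X) * (X ^ a * p) ^ 2 by ring]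
      exact hsub0 _ hp'
    · have hp' : X ^ a * p ≠ 0 := mul_ne_zero (pow_ne_zero _ X_ne_zero) hp
      rw [show X ^ (2 * a + 1) * ((C ρ - X) * p ^ 2) = X * ((C ρ - X) * (X ^ a * p) ^ 2) by ring]
      exact hsub1 _ hp'

/-- The moments `∑_{k ≤ n} c_k ρ^(n-k)`. -/
noncomputable def geomMoments (L : ℝ[X] →ₗ[ℝ] ℝ) (ρ : ℝ) : ℕ → ℝ
  | 0 => L 1
  | n + 1 => L (X ^ (n + 1)) + ρ * geomMoments L ρ n

lemma geomMoments_pos {L : ℝ[X] →ₗ[ℝ] ℝ} (hL : StrictlyPositive L) {ρ : ℝ} (hρ : 0 ≤ ρ) (n : ℕ) :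
    0 < geomMoments L ρ n := by
  have hp : ∀ n : ℕ, 0 < L (X ^ n) := fun n => hL _ (pow_ne_zero _ X_ne_zero) fun y hy => by
    have := hy.1; simp only [eval_pow, eval_X]; positivity
  induction n with
  | zero => simpa [geomMoments] using hp 0
  | succ n ih => have := hp (n + 1); rw [geomMoments]; positivity

/-- The recurrence reads ρ g_n - g_(n+1) = -c_(n+1). The functional with moments g_n is not
positive, but a factor ρ - X leads back to the positive L, with a minus sign. -/
lemma geomMoments_functional (L : ℝ[X] →ₗ[ℝ] ℝ) (ρ : ℝ) (p : ℝ[X]) :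
    momentFunctional (geomMoments L ρ) ((C ρ - X) * p) = -L (X * p) := by
  have : momentFunctional (geomMoments L ρ) ∘ₗ LinearMap.mulLeft ℝ (C ρ - X) =
      -(L ∘ₗ LinearMap.mulLeft ℝ X) := by
    refine linearMap_polynomial_ext fun n => ?_
    simp only [LinearMap.comp_apply, LinearMap.mulLeft_apply, LinearMap.neg_apply]
    rw [sub_mul, map_sub, linearMap_C_mul, ← pow_succ', momentFunctional_X_pow,
      momentFunctional_X_pow, geomMoments]
    ring
  simpa using LinearMap.congr_fun this p

lemma geomMoments_series (L : ℝ[X] →ₗ[ℝ] ℝ) (ρ : ℝ) :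
    (1 - PowerSeries.C ρ * PowerSeries.X) * momentSeries (momentFunctional (geomMoments L ρ)) =
      momentSeries L := by
  ext n
  rw [sub_mul, one_mul, mul_assoc, map_sub, PowerSeries.coeff_C_mul]
  cases n with
  | zero => simp [momentSeries, momentFunctional_X_pow, geomMoments, -pow_zero]
  | succ n =>
    rw [PowerSeries.coeff_succ_X_mul]
    simp [momentSeries, momentFunctional_X_pow, geomMoments]

lemma polynomial_eq_zero_of_X_pow_dvd {K : Type*} [CommRing K] {P : K[X]} {n : ℕ}
    (hP : P.natDegree < n)
    (h : (PowerSeries.X : PowerSeries K) ^ n ∣ (P : PowerSeries K)) : P = 0 := by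
  ext j
  rw [coeff_zero]
  by_cases hj : j < n
  · simpa using PowerSeries.X_pow_dvd_iff.1 h j hj
  · exact coeff_eq_zero_of_natDegree_lt (by omega)

/-- The numerators of the Padé approximants of a Stieltjes series with measure on `[0, 1/4]` have
no zeros in `[0, 4]`. -/
theorem pade_numerator_eq_zero {L : ℝ[X] →ₗ[ℝ] ℝ} (hL : StrictlyPositive L) (h1 : L 1 = 1)
    {l m : ℕ} {R Q : ℝ[X]} (hR : R.natDegree ≤ l) (hQ : Q.natDegree ≤ m)
    (h : (PowerSeries.X : PowerSeries ℝ) ^ (l + m + 1) ∣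
      (R : PowerSeries ℝ) - momentSeries L * (Q : PowerSeries ℝ))
    {x : ℝ} (hx0 : 0 ≤ x) (hx4 : x ≤ 4) (hx : R.eval x = 0) : R = 0 ∧ Q = 0 := by
  set M := l + m + 1 with hM
  have hQR : Q = 0 → R = 0 := by
    rintro rfl
    refine polynomial_eq_zero_of_X_pow_dvd (n := M) (by omega) ?_
    simpa using h
  have hinv := momentSeries_inverseFunctional L h1
  have hRQ : R = 0 → Q = 0 := by
    rintro rfl
    refine polynomial_eq_zero_of_X_pow_dvd (n := M) (by omega) ?_
    have h2 : (Q : PowerSeries ℝ) = -(1 - PowerSeries.X * momentSeries (inverseFunctional L)) *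
        (((0 : ℝ[X]) : PowerSeries ℝ) - momentSeries L * (Q : PowerSeries ℝ)) := by
      rw [Polynomial.coe_zero]
      linear_combination (-(Q : PowerSeries ℝ)) * hinv
    rw [h2]
    exact h.mul_left _
  suffices hs : R = 0 ∨ Q = 0 from hs.elim (fun h => ⟨h, hRQ h⟩) (fun h => ⟨hQR h, h⟩)
  have hρ : x ≠ 0 → 1 / 4 ≤ x⁻¹ := fun h0 => by
    rw [one_div]; exact inv_anti₀ (lt_of_le_of_ne hx0 (Ne.symm h0)) hx4
  -- For l ≤ m, use (1 - X D) R = Q mod X^M, D being the inverse moment series: the coefficients of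
  -- index m+1, …, m+l lie beyond both degrees, so those of X D R vanish. For m ≤ l, C Q or a
  -- modification of it plays this role, with Q reversed instead of R.
  rcases le_total l m with hlm | hlm
  · left
    rw [← reflect_eq_zero_iff (N := l)]
    have horth : ∀ t < l, inverseFunctional L (X ^ (m - l + t) * reflect l R) = 0 := by
      intro t ht
      rw [← coeff_momentSeries_mul _ _ _ _ hR, ← PowerSeries.coeff_succ_X_mul, ← mul_assoc]
      have h2 : PowerSeries.X * momentSeries (inverseFunctional L) * (R : PowerSeries ℝ) =
          (R : PowerSeries ℝ) - (Q : PowerSeries ℝ) - (1 - PowerSeries.X * momentSeries (inverseFunctional L)) *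
            ((R : PowerSeries ℝ) - momentSeries L * (Q : PowerSeries ℝ)) := by
        linear_combination (-(Q : PowerSeries ℝ)) * hinv
      rw [h2, map_sub, map_sub, Polynomial.coeff_coe, Polynomial.coeff_coe,
        coeff_eq_zero_of_natDegree_lt (by omega), coeff_eq_zero_of_natDegree_lt (by omega),
        PowerSeries.X_pow_dvd_iff.1 (h.mul_left _) _ (by omega)]
      simp
    by_cases h0 : x = 0
    · refine eq_zero_of_orthogonal (hL.stieltjesPos_inverse h1 le_rfl) (m - l) l _
        (natDegree_reflect_le' hR) horth (Or.inl (degree_reflect_lt hR ?_))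
      rw [coeff_zero_eq_eval_zero]; rwa [h0] at hx
    · exact eq_zero_of_orthogonal (hL.stieltjesPos_inverse h1 (hρ h0)) (m - l) l _
        (natDegree_reflect_le' hR) horth (Or.inr (eval_reflect_eq_zero hR h0 hx))
  · right
    rw [← reflect_eq_zero_iff (N := m)]
    by_cases h0 : x = 0
    · have hR0 : R.coeff 0 = 0 := by rw [coeff_zero_eq_eval_zero]; rwa [h0] at hx
      have hQ0 : Q.coeff 0 = 0 := by
        have := PowerSeries.X_pow_dvd_iff.1 h 0 (by omega)
        simpa [hR0, momentSeries, h1] using this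
      refine eq_zero_of_orthogonal (hL.stieltjesPos le_rfl) (l - m + 1) m _
        (natDegree_reflect_le' hQ) (fun t ht => ?_) (Or.inl (degree_reflect_lt hQ hQ0))
      rw [← coeff_momentSeries_mul _ _ _ _ hQ]
      have := PowerSeries.X_pow_dvd_iff.1 h (m + (l - m + 1 + t)) (by omega)
      rw [map_sub, Polynomial.coeff_coe, coeff_eq_zero_of_natDegree_lt (by omega), zero_sub,
        neg_eq_zero] at this
      exact this
    -- R = (X - x) R₁ = -x (1 - ρX) R₁. Dividing by the unit 1 - ρX replaces C by the series of `G`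
    -- and lowers the degree of the numerator, which gains one relation: the reversed Q is
    -- orthogonal for X^(l-m) G to all degrees ≤ m, its own included.
    · set ρ := x⁻¹ with hρdef
      have hρ := hρ h0
      set G := momentFunctional (geomMoments L ρ) with hG
      obtain ⟨R₁, hR₁⟩ := dvd_iff_isRoot.2 hx
      have hR₁deg : ∀ j, l ≤ j → R₁.coeff j = 0 := by
        intro j hj
        by_cases hz : R₁ = 0
        · simp [hz]
        · have : R.natDegree = 1 + R₁.natDegree := by
            rw [hR₁, natDegree_mul (X_sub_C_ne_zero x) hz, natDegree_X_sub_C]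
          exact coeff_eq_zero_of_natDegree_lt (by omega)
      have hunit : IsUnit (1 - PowerSeries.C ρ * PowerSeries.X : PowerSeries ℝ) := by
        rw [PowerSeries.isUnit_iff_constantCoeff]; simp
      have hdvd : (PowerSeries.X : PowerSeries ℝ) ^ M ∣
          momentSeries G * (Q : PowerSeries ℝ) + PowerSeries.C x * (R₁ : PowerSeries ℝ) := by
        have h2 : (1 - PowerSeries.C ρ * PowerSeries.X : PowerSeries ℝ) *
            (momentSeries G * (Q : PowerSeries ℝ) + PowerSeries.C x * (R₁ : PowerSeries ℝ)) =
            -((R : PowerSeries ℝ) - momentSeries L * (Q : PowerSeries ℝ)) := by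
          rw [mul_add, ← mul_assoc, hG, geomMoments_series, hR₁, Polynomial.coe_mul,
            Polynomial.coe_sub, Polynomial.coe_X, Polynomial.coe_C]
          have h3 : (PowerSeries.C ρ * PowerSeries.C x : PowerSeries ℝ) = 1 := by
            rw [← map_mul, hρdef, inv_mul_cancel₀ h0, map_one]
          linear_combination (-(PowerSeries.X : PowerSeries ℝ) * R₁) * h3
        rw [← (hunit.dvd_mul_left), h2]
        exact (dvd_neg.2 h)
      set F := reflect m Q with hF
      have hFdeg : F.natDegree ≤ m := natDegree_reflect_le' hQ
      have horth := orthogonal_of_moments G (l - m) (m + 1) F (fun t ht => by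
        rw [hF, ← coeff_momentSeries_mul _ _ _ _ hQ]
        have h2 := PowerSeries.X_pow_dvd_iff.1 hdvd (m + (l - m + t)) (by omega)
        rwa [map_add, PowerSeries.coeff_C_mul, Polynomial.coeff_coe, hR₁deg _ (by omega), mul_zero,
          add_zero] at h2)
      set q₀ := F.eval ρ with hq₀
      obtain ⟨r, hr⟩ : X - C ρ ∣ F - C q₀ := X_sub_C_dvd_sub_C_eval
      -- Write F = q₀ - (ρ - X) r and test against 2 q₀ - F = q₀ + (ρ - X) r. The product is q₀² -
      -- (ρ - X)² r², and G turns the last term into an L-value of definite sign.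
      have hrdeg : (F + C 2 * ((C ρ - X) * r)).degree < ((m + 1 : ℕ) : WithBot ℕ) := by
        have h3 : F + C 2 * ((C ρ - X) * r) = C (2 * q₀) - F := by
          rw [C_mul, show C (2 : ℝ) = 2 from rfl]
          linear_combination (2 : ℝ[X]) * hr
        rw [h3]
        refine (degree_le_of_natDegree_le (n := m) ?_).trans_lt (by exact_mod_cast Nat.lt_succ_self m)
        exact (natDegree_sub_le _ _).trans (max_le (by rw [natDegree_C]; omega) hFdeg)
      have hzero := horth _ hrdeg
      have hmain : q₀ ^ 2 * geomMoments L ρ (l - m) +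
          L (X ^ (l - m + 1) * ((C ρ - X) * r ^ 2)) = 0 := by
        have h4 : G (C (q₀ ^ 2) * X ^ (l - m)) =
            G (X ^ (l - m) * (F * (F + C 2 * ((C ρ - X) * r)))) +
              G ((C ρ - X) * (X ^ (l - m) * ((C ρ - X) * r ^ 2))) := by
          rw [← map_add]
          congr 1
          rw [C_pow, show C (2 : ℝ) = 2 from rfl]
          have h5 : C q₀ = F + (C ρ - X) * r := by linear_combination (-1 : ℝ[X]) * hr
          rw [h5]; ring
        rw [hzero, linearMap_C_mul, hG, momentFunctional_X_pow, geomMoments_functional, zero_add,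
          ← mul_assoc, ← pow_succ'] at h4
        linarith
      have hg := geomMoments_pos hL (by linarith : 0 ≤ ρ) (l - m)
      have hr0 : r = 0 := by
        by_contra hne
        have := (hL.stieltjesPos hρ).sub (l - m + 1) r hne
        nlinarith [mul_nonneg (sq_nonneg q₀) hg.le]
      rw [hr0] at hmain hr
      have hq0 : q₀ = 0 := by simpa [hg.ne'] using hmain
      simpa [hq0, sub_eq_zero] using hr

/-! ### The measure whose moments are the coefficients of C -/

lemma continuous_inner_integral (p : ℝ[X]) :
    Continuous fun t : ℝ => ∫ σ in (0 : ℝ)..1, p.eval (σ * (t * (1 - t))) := by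
  refine intervalIntegral.continuous_parametric_intervalIntegral_of_continuous' ?_ 0 1
  exact p.continuous.comp (by fun_prop)

lemma intervalIntegrable_inner (p : ℝ[X]) (t : ℝ) :
    IntervalIntegrable (fun σ : ℝ => p.eval (σ * (t * (1 - t)))) MeasureTheory.volume 0 1 :=
  (p.continuous.comp (by fun_prop)).intervalIntegrable _ _

/-- The functional whose moments are the coefficients of `C(X) = 4 (arcsin(√X / 2) / √X)²`. -/
noncomputable def arcsinFunctional : ℝ[X] →ₗ[ℝ] ℝ where
  toFun p := ∫ t in (0 : ℝ)..1, ∫ σ in (0 : ℝ)..1, p.eval (σ * (t * (1 - t)))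
  map_add' p q := by
    rw [← intervalIntegral.integral_add ((continuous_inner_integral p).intervalIntegrable _ _)
      ((continuous_inner_integral q).intervalIntegrable _ _)]
    refine intervalIntegral.integral_congr fun t _ => ?_
    simp only [eval_add]
    exact intervalIntegral.integral_add (intervalIntegrable_inner p t) (intervalIntegrable_inner q t)
  map_smul' a p := by
    simp [eval_smul]

lemma arcsinFunctional_apply (p : ℝ[X]) : arcsinFunctional p =
    ∫ t in (0 : ℝ)..1, ∫ σ in (0 : ℝ)..1, p.eval (σ * (t * (1 - t))) := rfl

lemma integral_pow_mul_one_sub_pow (n : ℕ) :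
    ∫ t in (0 : ℝ)..1, (t * (1 - t)) ^ n = (n.factorial : ℝ) ^ 2 / (2 * n + 1).factorial := by
  have hre : 0 < ((n : ℂ) + 1).re := by simp; positivity
  have h := Complex.Gamma_mul_Gamma_eq_betaIntegral hre hre
  rw [Complex.Gamma_nat_eq_factorial,
    show (n : ℂ) + 1 + (n + 1) = ((2 * n + 1 : ℕ) : ℂ) + 1 by push_cast; ring,
    Complex.Gamma_nat_eq_factorial, Complex.betaIntegral] at h
  have h2 : ∫ x in (0 : ℝ)..1, (x : ℂ) ^ ((n : ℂ) + 1 - 1) * (1 - (x : ℂ)) ^ ((n : ℂ) + 1 - 1) =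
      ((∫ t in (0 : ℝ)..1, (t * (1 - t)) ^ n : ℝ) : ℂ) := by
    rw [← intervalIntegral.integral_ofReal]
    refine intervalIntegral.integral_congr fun x _ => ?_
    simp only [add_sub_cancel_right, Complex.cpow_natCast]
    push_cast
    rw [mul_pow]
  rw [h2] at h
  have hne : ((2 * n + 1).factorial : ℝ) ≠ 0 := by positivity
  rw [eq_div_iff hne, mul_comm, pow_two]
  exact_mod_cast h.symm

/-- The coefficients of the series `C`. -/
noncomputable def arcsinCoeff (n : ℕ) : ℝ :=
  2 / (((n : ℝ) + 1) ^ 2 * ((Nat.choose (2 * n + 2) (n + 1) : ℕ) : ℝ))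

/-- The integral in σ gives 1/(n+1) and the one in t is the Beta value n!²/(2n+1)!. -/
lemma arcsinFunctional_X_pow (n : ℕ) : arcsinFunctional (X ^ n) = arcsinCoeff n := by
  have h1 : ∀ t : ℝ, ∫ σ in (0 : ℝ)..1, (X ^ n : ℝ[X]).eval (σ * (t * (1 - t))) =
      1 / ((n : ℝ) + 1) * (t * (1 - t)) ^ n := by
    intro t
    simp only [eval_pow, eval_X, mul_pow _ _ n]
    rw [intervalIntegral.integral_mul_const, integral_pow]
    simp
  rw [arcsinFunctional_apply]
  simp only [h1]
  rw [intervalIntegral.integral_const_mul, integral_pow_mul_one_sub_pow, arcsinCoeff]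
  have h2 := Nat.add_choose_mul_factorial_mul_factorial (n + 1) (n + 1)
  rw [show n + 1 + (n + 1) = 2 * n + 1 + 1 by ring] at h2
  have h3 : (((2 * n + 2).choose (n + 1) : ℕ) : ℝ) * (((n : ℝ) + 1) * n.factorial) ^ 2 =
      (2 * n + 2) * (2 * n + 1).factorial := by
    have := congrArg (Nat.cast : ℕ → ℝ) h2
    rw [Nat.factorial_succ (2 * n + 1), Nat.factorial_succ n] at this
    push_cast at this
    linear_combination this
  have hc : (0 : ℝ) < ((2 * n + 2).choose (n + 1) : ℕ) := by
    exact_mod_cast Nat.choose_pos (by omega)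
  have hf : (0 : ℝ) < (2 * n + 1).factorial := by positivity
  rw [div_mul_div_comm, div_eq_div_iff (by positivity) (by positivity)]
  linear_combination h3

lemma arcsinFunctional_one : arcsinFunctional 1 = 1 := by
  have := arcsinFunctional_X_pow 0
  simpa [arcsinCoeff] using this

/-- The argument σ t (1 - t) stays in [0, 1/4], and at t = 1/2 it sweeps that whole interval, so a
nonzero polynomial that is nonnegative there is positive somewhere on this slice. -/
lemma arcsinFunctional_pos : StrictlyPositive arcsinFunctional := by
  intro p hp hpos
  have hmem : ∀ t ∈ Set.Icc (0 : ℝ) 1, ∀ σ ∈ Set.Icc (0 : ℝ) 1,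
      0 ≤ p.eval (σ * (t * (1 - t))) := by
    intro t ht σ hσ
    have h1 : 0 ≤ t * (1 - t) := mul_nonneg ht.1 (sub_nonneg.2 ht.2)
    refine hpos _ ⟨mul_nonneg hσ.1 h1, ?_⟩
    nlinarith [sq_nonneg (t - 1 / 2), mul_nonneg (sub_nonneg.2 hσ.2) h1]
  have hex : ∃ σ ∈ Set.Icc (0 : ℝ) 1, 0 < p.eval (σ * (1 / 2 * (1 - 1 / 2))) := by
    by_contra! hcon
    refine hp (eq_zero_of_infinite_isRoot p ?_)
    refine (Set.Icc_infinite (show (0 : ℝ) < 1 / 4 by norm_num)).mono fun y hy => ?_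
    have h1 := hcon (4 * y) ⟨by linarith [hy.1], by linarith [hy.2]⟩
    rw [show 4 * y * (1 / 2 * (1 - 1 / 2)) = y by ring] at h1
    exact le_antisymm h1 (hpos y hy)
  rw [arcsinFunctional_apply]
  refine intervalIntegral.integral_pos one_pos (continuous_inner_integral p).continuousOn
    (fun t ht => intervalIntegral.integral_nonneg zero_le_one
      fun σ hσ => hmem t (Set.Ioc_subset_Icc_self ht) σ hσ) ⟨1 / 2, by norm_num, ?_⟩
  refine intervalIntegral.integral_pos one_pos ?_ (fun σ hσ => hmem (1 / 2) (by norm_num) σ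
    (Set.Ioc_subset_Icc_self hσ)) hex
  exact (p.continuous.comp (by fun_prop)).continuousOn

/-- The polynomial obtained by applying a real linear form to the coefficients. -/
noncomputable def mapLinear (φ : ℂ →ₗ[ℝ] ℝ) (P : ℂ[X]) : ℝ[X] :=
  ∑ i ∈ Finset.range (P.natDegree + 1), monomial i (φ (P.coeff i))

lemma coeff_mapLinear (φ : ℂ →ₗ[ℝ] ℝ) (P : ℂ[X]) (j : ℕ) :
    (mapLinear φ P).coeff j = φ (P.coeff j) := by
  rw [mapLinear, finsetSum_coeff]
  simp only [coeff_monomial]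
  rw [Finset.sum_ite_eq']
  split_ifs with h
  · rfl
  · rw [Finset.mem_range, not_lt] at h
    rw [coeff_eq_zero_of_natDegree_lt (by omega), map_zero]

lemma natDegree_mapLinear_le (φ : ℂ →ₗ[ℝ] ℝ) (P : ℂ[X]) :
    (mapLinear φ P).natDegree ≤ P.natDegree := by
  rw [natDegree_le_iff_coeff_eq_zero]
  intro j hj
  rw [coeff_mapLinear, coeff_eq_zero_of_natDegree_lt hj, map_zero]

lemma linear_ofReal_mul (φ : ℂ →ₗ[ℝ] ℝ) (a : ℝ) (z : ℂ) : φ ((a : ℂ) * z) = a * φ z := by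
  rw [← Complex.real_smul, map_smul, smul_eq_mul]

lemma eval_mapLinear (φ : ℂ →ₗ[ℝ] ℝ) (P : ℂ[X]) (x : ℝ) :
    (mapLinear φ P).eval x = φ (P.eval (x : ℂ)) := by
  rw [mapLinear, eval_finsetSum, eval_eq_sum_range, map_sum]
  refine Finset.sum_congr rfl fun i _ => ?_
  rw [eval_monomial, mul_comm (P.coeff i), ← Complex.ofReal_pow, linear_ofReal_mul, mul_comm]

lemma coeff_CSeries (n : ℕ) : PowerSeries.coeff n CompactFD.CSeries = (arcsinCoeff n : ℂ) := by
  rw [CompactFD.CSeries, PowerSeries.coeff_mk, arcsinCoeff]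
  push_cast
  rfl

lemma mapLinear_approx (φ : ℂ →ₗ[ℝ] ℝ) {R Q : ℂ[X]} {n : ℕ}
    (h : (PowerSeries.X : PowerSeries ℂ) ^ n ∣
      (R : PowerSeries ℂ) - CompactFD.CSeries * (Q : PowerSeries ℂ)) :
    (PowerSeries.X : PowerSeries ℝ) ^ n ∣ (mapLinear φ R : PowerSeries ℝ) -
      momentSeries arcsinFunctional * (mapLinear φ Q : PowerSeries ℝ) := by
  rw [PowerSeries.X_pow_dvd_iff] at h ⊢
  intro j hj
  have := congrArg φ (h j hj)
  rw [map_sub, PowerSeries.coeff_mul, map_sub, map_sum, map_zero] at this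
  rw [map_sub, PowerSeries.coeff_mul, ← this]
  simp only [Polynomial.coeff_coe, coeff_mapLinear, coeff_CSeries, linear_ofReal_mul, momentSeries,
    PowerSeries.coeff_mk, arcsinFunctional_X_pow]

/-- Since `x` and the coefficients of C are real, real and imaginary parts of the pair satisfy the
same relation and vanish at the same point, so the real theorem kills both. -/
theorem CompactFD.IsPadePair.eval_ne_zero {l m : ℕ} {R Q : ℂ[X]}
    (h : CompactFD.IsPadePair l m R Q) {x : ℝ} (hx : x ∈ Set.Icc (0 : ℝ) 4) :
    R.eval (x : ℂ) ≠ 0 := by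
  intro h0
  have key : ∀ φ : ℂ →ₗ[ℝ] ℝ, mapLinear φ R = 0 ∧ mapLinear φ Q = 0 := fun φ =>
    pade_numerator_eq_zero arcsinFunctional_pos arcsinFunctional_one
      ((natDegree_mapLinear_le φ R).trans h.deg_num) ((natDegree_mapLinear_le φ Q).trans h.deg_den)
      (mapLinear_approx φ h.approx) hx.1 hx.2 (by rw [eval_mapLinear, h0, map_zero])
  have hz : ∀ P : ℂ[X], (∀ φ : ℂ →ₗ[ℝ] ℝ, mapLinear φ P = 0) → P = 0 := by
    intro P hP
    ext j
    have hre := congrArg (coeff · j) (hP Complex.reLm)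
    have him := congrArg (coeff · j) (hP Complex.imLm)
    simp only [coeff_mapLinear, coeff_zero, Complex.reLm_coe, Complex.imLm_coe] at hre him
    exact Complex.ext hre him
  exact h.ne_zero (Prod.ext (hz R fun φ => (key φ).1) (hz Q fun φ => (key φ).2))

/-- The Padé approximants of `C` have no excess order of approximation. -/
theorem CompactFD.IsPadePair.not_dvd {l m : ℕ} {R Q : ℂ[X]} (h : CompactFD.IsPadePair l m R Q) :
    ¬ (PowerSeries.X : PowerSeries ℂ) ^ (l + m + 2) ∣
      (R : PowerSeries ℂ) - CompactFD.CSeries * (Q : PowerSeries ℂ) := by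
  intro hd
  -- One extra order is just what the larger type requires after multiplication by X, but the new
  -- numerator vanishes at 0.
  have hP : CompactFD.IsPadePair (l + 1) (m + 1) (X * R) (X * Q) := by
    refine ⟨fun h0 => h.ne_zero ?_, ?_, ?_, ?_⟩
    · simp only [Prod.mk.injEq, mul_eq_zero, X_ne_zero, false_or] at h0 ⊢
      exact h0
    · exact natDegree_mul_le.trans (by have := h.deg_num; rw [natDegree_X]; omega)
    · exact natDegree_mul_le.trans (by have := h.deg_den; rw [natDegree_X]; omega)
    · rw [show l + 1 + (m + 1) + 1 = l + m + 2 + 1 by ring, pow_succ', Polynomial.coe_mul,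
        Polynomial.coe_mul, Polynomial.coe_X, mul_left_comm, ← mul_sub]
      exact mul_dvd_mul_left _ hd
  exact hP.eval_ne_zero (x := 0) (by norm_num) (by simp)

/-- There are l + m + 2 unknown coefficients for l + m + 1 linear equations. -/
theorem exists_isPadePair (l m : ℕ) : ∃ R Q : ℂ[X], CompactFD.IsPadePair l m R Q := by
  let Φ : (degreeLT ℂ (l + 1) × degreeLT ℂ (m + 1)) →ₗ[ℂ] (Fin (l + m + 1) → ℂ) :=
    { toFun := fun P i => PowerSeries.coeff (i : ℕ) (((P.1 : ℂ[X]) : PowerSeries ℂ) -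
        CompactFD.CSeries * ((P.2 : ℂ[X]) : PowerSeries ℂ))
      map_add' := fun P P' => by
        ext i
        simp only [Prod.fst_add, Prod.snd_add, Submodule.coe_add, Polynomial.coe_add, mul_add,
          Pi.add_apply, ← map_add]
        congr 1; ring
      map_smul' := fun a P => by
        ext i
        simp only [Prod.smul_fst, Prod.smul_snd, Submodule.coe_smul, Polynomial.coe_smul,
          mul_smul_comm, ← smul_sub, map_smul, RingHom.id_apply, Pi.smul_apply] }
  have hfin : ∀ n, Module.finrank ℂ (degreeLT ℂ n) = n := fun n => by
    rw [(degreeLTEquiv ℂ n).finrank_eq, Module.finrank_fin_fun]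
  have : ∀ n, FiniteDimensional ℂ (degreeLT ℂ n) := fun n =>
    Module.Finite.equiv (degreeLTEquiv ℂ n).symm
  have hker : LinearMap.ker Φ ≠ ⊥ := by
    apply LinearMap.ker_ne_bot_of_finrank_lt
    rw [Module.finrank_prod, hfin, hfin, Module.finrank_fin_fun]
    omega
  obtain ⟨⟨R, Q⟩, hmem, hne⟩ := Submodule.exists_mem_ne_zero_of_ne_bot hker
  refine ⟨R, Q, ⟨fun h0 => hne ?_, ?_, ?_, ?_⟩⟩
  · have h1 : (R : ℂ[X]) = 0 := congrArg Prod.fst h0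
    have h2 : (Q : ℂ[X]) = 0 := congrArg Prod.snd h0
    exact Prod.ext (Subtype.ext h1) (Subtype.ext h2)
  · have := mem_degreeLT.1 R.2
    exact natDegree_le_iff_coeff_eq_zero.2 fun j hj =>
      (degree_lt_iff_coeff_zero _ _).1 this j hj
  · have := mem_degreeLT.1 Q.2
    exact natDegree_le_iff_coeff_eq_zero.2 fun j hj =>
      (degree_lt_iff_coeff_zero _ _).1 this j hj
  · rw [PowerSeries.X_pow_dvd_iff]
    intro j hj
    exact congrFun (LinearMap.mem_ker.1 hmem) ⟨j, hj⟩

end Pade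

/-! ### Symbols of formulas and the order conditions -/

section Symbols

open Polynomial CompactFD

/-- The series `exp(j t)`. -/
noncomputable def expSeries (j : ℤ) : PowerSeries ℂ :=
  PowerSeries.rescale (j : ℂ) (PowerSeries.exp ℂ)

lemma expSeries_add (i j : ℤ) : expSeries (i + j) = expSeries i * expSeries j := by
  rw [expSeries, expSeries, expSeries, PowerSeries.exp_mul_exp_eq_exp_add, Int.cast_add]

lemma expSeries_zero : expSeries 0 = 1 := by
  ext n
  rw [expSeries, PowerSeries.coeff_rescale, PowerSeries.coeff_exp, PowerSeries.coeff_one]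
  rcases n with _ | n <;> simp

lemma coeff_expSeries (j : ℤ) (n : ℕ) :
    PowerSeries.coeff n (expSeries j) = (j : ℂ) ^ n / n.factorial := by
  rw [expSeries, PowerSeries.coeff_rescale, PowerSeries.coeff_exp]
  simp [div_eq_mul_inv]

lemma derivative_expSeries (j : ℤ) :
    PowerSeries.derivative ℂ (expSeries j) = PowerSeries.C (j : ℂ) * expSeries j := by
  ext n
  rw [PowerSeries.coeff_derivative, PowerSeries.coeff_C_mul, coeff_expSeries, coeff_expSeries,
    Nat.factorial_succ]
  have h1 : ((n : ℂ) + 1) ≠ 0 := by exact_mod_cast Nat.succ_ne_zero n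
  have h2 : ((n.factorial : ℕ) : ℂ) ≠ 0 := by exact_mod_cast n.factorial_ne_zero
  push_cast
  field_simp
  ring

/-- The symbol `∑_j b_j exp(j t)` of a formula. -/
noncomputable def symb : Formula →ₗ[ℂ] PowerSeries ℂ := Finsupp.linearCombination ℂ expSeries

/-- The translate of a formula. -/
noncomputable def shiftFormula (a : ℤ) : Formula →ₗ[ℂ] Formula :=
  Finsupp.lmapDomain ℂ ℂ (fun j => j + a)

lemma shiftFormula_single (a j : ℤ) (c : ℂ) :
    shiftFormula a (Finsupp.single j c) = Finsupp.single (j + a) c := by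
  simp [shiftFormula]

lemma shiftFormula_apply (a : ℤ) (b : Formula) (j : ℤ) : shiftFormula a b j = b (j - a) := by
  have := Finsupp.mapDomain_apply (add_left_injective a) b (j - a)
  simpa [shiftFormula] using this

lemma symb_shiftFormula (a : ℤ) (b : Formula) :
    symb (shiftFormula a b) = expSeries a * symb b := by
  have : symb ∘ₗ shiftFormula a = LinearMap.mulLeft ℂ (expSeries a) ∘ₗ symb := by
    refine Finsupp.lhom_ext fun j c => ?_
    simp only [LinearMap.comp_apply, shiftFormula_single, symb, Finsupp.linearCombination_single,
      LinearMap.mulLeft_apply, expSeries_add, mul_smul_comm]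
    rw [mul_comm]
  exact LinearMap.congr_fun this b

/-- Convolution by the formula `(-1, 2, -1)`. -/
noncomputable def deltaFormula : Module.End ℂ Formula :=
  2 - shiftFormula 1 - shiftFormula (-1)

lemma deltaFormula_apply' (b : Formula) :
    deltaFormula b = (2 : ℂ) • b - shiftFormula 1 b - shiftFormula (-1) b := by
  rw [deltaFormula, LinearMap.sub_apply, LinearMap.sub_apply]
  rw [show (2 : Module.End ℂ Formula) b = (2 : ℂ) • b by
    rw [show (2 : Module.End ℂ Formula) = 1 + 1 from one_add_one_eq_two.symm, LinearMap.add_apply,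
      two_smul]; rfl]

lemma deltaFormula_apply (b : Formula) (j : ℤ) :
    deltaFormula b j = 2 * b j - b (j - 1) - b (j + 1) := by
  rw [deltaFormula_apply', Finsupp.sub_apply, Finsupp.sub_apply, shiftFormula_apply,
    shiftFormula_apply, Finsupp.smul_apply, smul_eq_mul, sub_neg_eq_add]

/-- The series `2 - exp(t) - exp(-t)`. -/
noncomputable def deltaSeries : PowerSeries ℂ := 2 - expSeries 1 - expSeries (-1)

lemma symb_deltaFormula (b : Formula) : symb (deltaFormula b) = deltaSeries * symb b := by
  rw [deltaFormula_apply', map_sub, map_sub, map_smul, symb_shiftFormula, symb_shiftFormula,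
    deltaSeries, two_smul]
  ring

/-- The symmetric formula whose convolution operator is the polynomial `P` of that of
`(-1, 2, -1)`. -/
noncomputable def ofPoly : ℂ[X] →ₗ[ℂ] Formula :=
  LinearMap.applyₗ (Finsupp.single (0 : ℤ) (1 : ℂ)) ∘ₗ (aeval deltaFormula).toLinearMap

lemma ofPoly_apply (P : ℂ[X]) : ofPoly P = aeval deltaFormula P (Finsupp.single 0 1) := rfl

lemma ofPoly_C (a : ℂ) : ofPoly (C a) = Finsupp.single 0 a := by
  rw [ofPoly_apply, aeval_C, Module.algebraMap_end_apply]; simp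

lemma ofPoly_X_mul (P : ℂ[X]) : ofPoly (X * P) = deltaFormula (ofPoly P) := by
  rw [ofPoly_apply, map_mul, aeval_X, Module.End.mul_apply, ofPoly_apply]

/-- A linear property of the formulas `ofPoly P` follows by induction on `P`. -/
lemma ofPoly_induction {p : ℂ[X] → Prop} (hC : ∀ a, p (C a)) (hadd : ∀ P Q, p P → p Q → p (P + Q))
    (hX : ∀ P, p P → p (X * P)) (P : ℂ[X]) : p P := by
  induction P using Polynomial.induction_on with
  | C a => exact hC a
  | add P Q hP hQ => exact hadd P Q hP hQ
  | monomial n a h =>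
    rw [pow_succ, ← mul_assoc, mul_comm]
    exact hX _ h

lemma symb_ofPoly (P : ℂ[X]) : symb (ofPoly P) = aeval deltaSeries P := by
  induction P using ofPoly_induction with
  | hC a =>
    rw [ofPoly_C, symb, Finsupp.linearCombination_single, expSeries_zero, aeval_C,
      Algebra.algebraMap_eq_smul_one]
  | hadd P Q hP hQ => rw [map_add, map_add, map_add, hP, hQ]
  | hX P h => rw [ofPoly_X_mul, symb_deltaFormula, h, map_mul, aeval_X]

lemma isSymm_ofPoly (P : ℂ[X]) : IsSymm (ofPoly P) := by
  induction P using ofPoly_induction with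
  | hC a =>
    intro j
    rw [ofPoly_C, Finsupp.single_apply, Finsupp.single_apply]
    simp only [show (0 = j) ↔ (0 = -j) by omega]
  | hadd P Q hP hQ =>
    intro j
    rw [map_add, Finsupp.add_apply, Finsupp.add_apply, hP j, hQ j]
  | hX P h =>
    intro j
    rw [ofPoly_X_mul, deltaFormula_apply, deltaFormula_apply, h j, h (j - 1), h (j + 1),
      show -(j - 1) = -j + 1 by ring, show -(j + 1) = -j - 1 by ring]
    ring

lemma ofPoly_X_pow (k : ℕ) :
    StencilLE (ofPoly (X ^ k)) k ∧ ofPoly (X ^ k) (k : ℤ) = (-1) ^ k := by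
  induction k with
  | zero =>
    rw [pow_zero, ← C_1, ofPoly_C]
    refine ⟨fun j hj => Finsupp.single_eq_of_ne (by push_cast at hj; omega), by simp⟩
  | succ k ih =>
    rw [pow_succ', ofPoly_X_mul]
    constructor
    · intro j hj
      push_cast at hj
      rw [deltaFormula_apply, ih.1 j (by omega), ih.1 (j - 1) (by omega), ih.1 (j + 1) (by omega)]
      simp
    · push_cast
      rw [deltaFormula_apply, ih.1 _ (by omega), ih.1 _ (by omega : (k : ℤ) < k + 1 + 1),
        add_sub_cancel_right, ih.2]
      ring

lemma stencilLE_ofPoly {P : ℂ[X]} {k : ℕ} (hP : P.natDegree ≤ k) : StencilLE (ofPoly P) k := by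
  refine Polynomial.induction_with_natDegree_le (fun P => StencilLE (ofPoly P) k) k ?_
    (fun i a _ hi => ?_) (fun f g _ _ hf hg => ?_) P hP
  · intro j _; simp
  · intro j hj
    rw [← smul_eq_C_mul, map_smul, Finsupp.smul_apply, (ofPoly_X_pow i).1 j (by omega), smul_zero]
  · intro j hj
    rw [map_add, Finsupp.add_apply, hf j hj, hg j hj, add_zero]

/-- The k-th power of Δ has outermost value (-1)^k, so the outermost value of a symmetric formula
can be peeled off by a multiple of it. -/
lemma exists_ofPoly {b : Formula} (hb : IsSymm b) {k : ℕ} (hk : StencilLE b k) :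
    ∃ P : ℂ[X], P.natDegree ≤ k ∧ b = ofPoly P := by
  induction k generalizing b with
  | zero =>
    refine ⟨C (b 0), by simp, ?_⟩
    rw [ofPoly_C]
    ext j
    rw [Finsupp.single_apply]
    split_ifs with h
    · rw [h]
    · rcases lt_or_gt_of_ne h with h | h
      · exact hk j h
      · rw [hb j]; exact hk _ (by push_cast; omega)
  | succ k ih =>
    set a : ℂ := (-1) ^ (k + 1) * b ((k + 1 : ℕ) : ℤ) with ha
    have hX := ofPoly_X_pow (k + 1)
    have hs := isSymm_ofPoly (X ^ (k + 1))
    obtain ⟨P, hP, hbP⟩ := ih (b := b - a • ofPoly (X ^ (k + 1))) (fun j => by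
      simp only [Finsupp.sub_apply, Finsupp.smul_apply]; rw [hb j, hs j]) (fun j hj => by
      rw [Finsupp.sub_apply, Finsupp.smul_apply, smul_eq_mul]
      rcases (show j = ((k + 1 : ℕ) : ℤ) ∨ ((k + 1 : ℕ) : ℤ) < j by push_cast; omega) with rfl | h
      · rw [hX.2, ha, mul_right_comm, ← mul_pow]; norm_num
      · rw [hk j h, hX.1 j h]; simp)
    refine ⟨P + a • X ^ (k + 1), ?_, ?_⟩
    · refine (natDegree_add_le _ _).trans (max_le (by omega) ?_)
      exact (natDegree_smul_le _ _).trans (by simp)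
    · rw [map_add, map_smul, ← hbP]; simp

lemma derivative_deltaSeries : PowerSeries.derivative ℂ deltaSeries =
    expSeries (-1) - expSeries 1 := by
  rw [deltaSeries, map_sub, map_sub, derivative_expSeries, derivative_expSeries,
    show (2 : PowerSeries ℂ) = ((2 : ℕ) : PowerSeries ℂ) by norm_cast, Derivation.map_natCast]
  push_cast
  rw [map_one, map_neg, map_one]
  ring

lemma expSeries_one_mul : expSeries 1 * expSeries (-1) = 1 := by
  rw [← expSeries_add, add_neg_cancel, expSeries_zero]

lemma derivative_deltaSeries_sq :
    (PowerSeries.derivative ℂ deltaSeries) ^ 2 = deltaSeries * (deltaSeries - 4) := by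
  rw [derivative_deltaSeries, deltaSeries]
  linear_combination (-4 : PowerSeries ℂ) * expSeries_one_mul

lemma derivative_derivative_deltaSeries :
    PowerSeries.derivative ℂ (PowerSeries.derivative ℂ deltaSeries) = deltaSeries - 2 := by
  rw [derivative_deltaSeries, map_sub, derivative_expSeries, derivative_expSeries, deltaSeries]
  push_cast
  rw [map_one, map_neg, map_one]
  ring

lemma coeff_deltaSeries (n : ℕ) : PowerSeries.coeff n deltaSeries =
    (if n = 0 then 2 else 0) - (1 + (-1) ^ n) / n.factorial := by
  rw [deltaSeries, map_sub, map_sub, coeff_expSeries, coeff_expSeries,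
    show (2 : PowerSeries ℂ) = PowerSeries.C 2 from (map_ofNat PowerSeries.C 2).symm, PowerSeries.coeff_C]
  push_cast
  rw [one_pow]
  ring

lemma exists_deltaSeries_eq : ∃ v : PowerSeries ℂ,
    deltaSeries = PowerSeries.X ^ 2 * v ∧ PowerSeries.constantCoeff v = -1 := by
  have h : (PowerSeries.X : PowerSeries ℂ) ^ 2 ∣ deltaSeries := by
    rw [PowerSeries.X_pow_dvd_iff]
    intro m hm
    rw [coeff_deltaSeries]
    interval_cases m <;> norm_num
  obtain ⟨v, hv⟩ := h
  refine ⟨v, hv, ?_⟩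
  have := coeff_deltaSeries 2
  rw [hv, show (2 : ℕ) = 0 + 2 by norm_num, mul_comm, PowerSeries.coeff_mul_X_pow] at this
  rw [← PowerSeries.coeff_zero_eq_constantCoeff_apply, this]
  norm_num

/-- The truncations of the series `X C(X) = 4 arcsin(√X / 2)²`. -/
noncomputable def arcsinTrunc (n : ℕ) : ℂ[X] :=
  ∑ i ∈ Finset.range n, C (arcsinCoeff i : ℂ) * X ^ (i + 1)

lemma arcsinCoeff_succ (n : ℕ) :
    arcsinCoeff (n + 1) * ((n + 2) * (4 * n + 6)) = (n + 1) ^ 2 * arcsinCoeff n := by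
  rw [arcsinCoeff, arcsinCoeff]
  have h := Nat.succ_mul_centralBinom_succ (n + 1)
  rw [Nat.centralBinom_eq_two_mul_choose, Nat.centralBinom_eq_two_mul_choose] at h
  have h' := congrArg (Nat.cast : ℕ → ℝ) h
  rw [show 2 * (n + 1 + 1) = 2 * (n + 1) + 2 by ring, show 2 * (n + 1) = 2 * n + 2 by ring] at h'
  rw [show 2 * (n + 1) = 2 * n + 2 by ring]
  push_cast at h' ⊢
  have h1 : (0 : ℝ) < ((2 * n + 2).choose (n + 1) : ℕ) := by
    exact_mod_cast Nat.choose_pos (by omega)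
  have h2 : (0 : ℝ) < ((2 * n + 2 + 2).choose (n + 1 + 1) : ℕ) := by
    exact_mod_cast Nat.choose_pos (by omega)
  field_simp
  linear_combination (-2 - (n : ℝ)) * h'

/-- The series y = X C(X) solves X(4 - X) y'' + (2 - X) y' = 2. By the two-term recurrence of its
coefficients, truncation leaves a single monomial as defect. -/
lemma arcsinTrunc_ode (n : ℕ) :
    X * (4 - X) * derivative (derivative (arcsinTrunc n)) + (2 - X) * derivative (arcsinTrunc n) =
      2 - C ((arcsinCoeff n : ℂ) * ((n + 1) * (4 * n + 2))) * X ^ n := by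
  induction n with
  | zero =>
    have : arcsinCoeff 0 = 1 := by norm_num [arcsinCoeff]
    rw [this]
    simp [arcsinTrunc, show C (2 : ℂ) = 2 from rfl]
  | succ n ih =>
    have hrec := congrArg (Complex.ofReal) (arcsinCoeff_succ n)
    push_cast at hrec
    have hC := congrArg (C : ℂ → ℂ[X]) hrec
    have h1 : arcsinTrunc (n + 1) = arcsinTrunc n + C (arcsinCoeff n : ℂ) * X ^ (n + 1) :=
      Finset.sum_range_succ _ _
    have hd1 : derivative (C (arcsinCoeff n : ℂ) * X ^ (n + 1)) =
        C (arcsinCoeff n : ℂ) * (C ((n : ℂ) + 1) * X ^ n) := by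
      rw [derivative_C_mul, derivative_X_pow]; simp
    have hd2 : X * derivative (C (arcsinCoeff n : ℂ) * (C ((n : ℂ) + 1) * X ^ n)) =
        C (arcsinCoeff n : ℂ) * (C ((n : ℂ) + 1) * (C (n : ℂ) * X ^ n)) := by
      rw [derivative_C_mul, derivative_C_mul, derivative_X_pow]
      cases n with
      | zero => simp
      | succ n => simp only [Nat.add_sub_cancel]; ring
    rw [h1, map_add, hd1, map_add]
    simp only [map_mul, map_add, map_pow, map_natCast, map_ofNat, map_one] at *
    push_cast
    linear_combination ih + (4 - X) * hd2 + X ^ (n + 1) * hC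

/-- This is 4 arcsin(√δ / 2)² = -t². As δ'² = δ(δ - 4) and δ'' = δ - 2, the chain rule turns the
equation of `arcsinTrunc_ode` into G'' = -2 + O(t^(2n)); the constants of integration vanish because
t² divides G. -/
lemma X_pow_dvd_arcsinTrunc_add (n : ℕ) : (PowerSeries.X : PowerSeries ℂ) ^ (2 * n + 2) ∣
    aeval deltaSeries (arcsinTrunc n) + PowerSeries.X ^ 2 := by
  set G := aeval deltaSeries (arcsinTrunc n) with hG
  have hode := congrArg (aeval deltaSeries) (arcsinTrunc_ode n)
  have hd : PowerSeries.derivative ℂ (PowerSeries.derivative ℂ G) = -2 +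
      PowerSeries.C ((arcsinCoeff n : ℂ) * ((n + 1) * (4 * n + 2))) * deltaSeries ^ n := by
    rw [hG, Derivation.map_aeval, smul_eq_mul, Derivation.leibniz, Derivation.map_aeval,
      derivative_derivative_deltaSeries, smul_eq_mul, smul_eq_mul, smul_eq_mul]
    have h2 := derivative_deltaSeries_sq
    simp only [map_add, map_mul, map_sub, aeval_X, aeval_C, map_pow, map_ofNat] at hode ⊢
    simp only [← PowerSeries.algebraMap_eq] at hode ⊢
    linear_combination (aeval deltaSeries (derivative (derivative (arcsinTrunc n)))) * h2 - hode
  obtain ⟨v, hv, -⟩ := exists_deltaSeries_eq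
  have hX2 : (PowerSeries.X : PowerSeries ℂ) ^ 2 ∣ G := by
    have : (X : ℂ[X]) ∣ arcsinTrunc n := by
      refine Finset.dvd_sum fun i _ => ?_
      rw [pow_succ, ← mul_assoc]; exact dvd_mul_left _ _
    obtain ⟨P, hP⟩ := this
    rw [hG, hP, map_mul, aeval_X, hv, mul_assoc]
    exact dvd_mul_right _ _
  rw [PowerSeries.X_pow_dvd_iff]
  intro k hk
  rw [map_add, PowerSeries.coeff_X_pow]
  rcases Nat.lt_or_ge k 2 with h2 | h2
  · rw [PowerSeries.X_pow_dvd_iff.1 hX2 k h2, if_neg (by omega), zero_add]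
  · obtain ⟨j, rfl⟩ := Nat.exists_eq_add_of_le' h2
    have hj := congrArg (PowerSeries.coeff j) hd
    rw [PowerSeries.coeff_derivative, PowerSeries.coeff_derivative, map_add,
      PowerSeries.coeff_C_mul, hv, mul_pow, ← pow_mul, PowerSeries.coeff_X_pow_mul',
      if_neg (by omega), mul_zero, add_zero, map_neg,
      show (2 : PowerSeries ℂ) = PowerSeries.C 2 from (map_ofNat PowerSeries.C 2).symm, PowerSeries.coeff_C] at hj
    have hj1 : ((j : ℂ) + 1) ≠ 0 := by exact_mod_cast Nat.succ_ne_zero j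
    have hj2 : (((j + 1 : ℕ) : ℂ) + 1) ≠ 0 := by exact_mod_cast Nat.succ_ne_zero (j + 1)
    by_cases h0 : j = 0
    · subst h0
      norm_num at hj ⊢
      linear_combination (1 / 2 : ℂ) * hj
    · rw [if_neg h0, neg_zero, mul_eq_zero, mul_eq_zero] at hj
      rw [if_neg (by omega), add_zero]
      exact (hj.resolve_right hj1).resolve_right hj2

/-- δ is t² times a unit, so substituting it doubles orders of vanishing. -/
lemma X_pow_dvd_aeval_deltaSeries (K : ℕ) (P : ℂ[X]) :
    (PowerSeries.X : PowerSeries ℂ) ^ (2 * K) ∣ aeval deltaSeries P ↔ X ^ K ∣ P := by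
  obtain ⟨v, hv, hv0⟩ := exists_deltaSeries_eq
  have hunit : IsUnit v := by rw [PowerSeries.isUnit_iff_constantCoeff, hv0]; simp
  constructor
  · intro h
    induction K generalizing P with
    | zero => simp
    | succ K ih =>
      have h0 : P.coeff 0 = 0 := by
        have h1 := PowerSeries.X_pow_dvd_iff.1 h 0 (by omega)
        rw [← P.divX_mul_X_add] at h1
        rw [map_add, map_mul, aeval_X, aeval_C, hv] at h1
        simpa using h1
      obtain ⟨P₁, rfl⟩ := X_dvd_iff.2 h0
      rw [map_mul, aeval_X] at h
      set A := aeval deltaSeries P₁ with hA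
      rw [hv, mul_assoc, show 2 * (K + 1) = 2 + 2 * K by ring, pow_add] at h
      have h2 := (mul_dvd_mul_iff_left (pow_ne_zero 2 PowerSeries.X_ne_zero)).1 h
      rw [hunit.dvd_mul_left] at h2
      rw [pow_succ']
      exact mul_dvd_mul_left _ (ih P₁ h2)
  · rintro ⟨P₁, rfl⟩
    rw [map_mul, map_pow, aeval_X, hv, mul_pow, ← pow_mul, mul_assoc]
    exact dvd_mul_right _ _

/-- The order conditions for a pair of symmetric formulas, in terms of its polynomials. -/
lemma X_pow_dvd_symb_iff (D Q : ℂ[X]) (K : ℕ) :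
    (PowerSeries.X : PowerSeries ℂ) ^ (2 * K) ∣
      symb (ofPoly D) + PowerSeries.X ^ 2 * symb (ofPoly Q) ↔
    (PowerSeries.X : PowerSeries ℂ) ^ K ∣
      (D : PowerSeries ℂ) - PowerSeries.X * (CSeries * (Q : PowerSeries ℂ)) := by
  rw [symb_ofPoly, symb_ofPoly]
  -- Replace t² by minus the truncated arcsin series in δ, at the cost of order 2K + 2: only
  -- polynomials are ever substituted.
  have h1 : aeval deltaSeries D + PowerSeries.X ^ 2 * aeval deltaSeries Q =
      aeval deltaSeries (D - arcsinTrunc K * Q) +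
        (aeval deltaSeries (arcsinTrunc K) + PowerSeries.X ^ 2) * aeval deltaSeries Q := by
    rw [map_sub, map_mul]; ring
  have h2 : (PowerSeries.X : PowerSeries ℂ) ^ (2 * K) ∣
      (aeval deltaSeries (arcsinTrunc K) + PowerSeries.X ^ 2) * aeval deltaSeries Q :=
    ((pow_dvd_pow _ (by omega)).trans (X_pow_dvd_arcsinTrunc_add K)).mul_right _
  have h3 : (PowerSeries.X : PowerSeries ℂ) ^ K ∣
      (arcsinTrunc K : PowerSeries ℂ) - PowerSeries.X * CSeries := by
    rw [PowerSeries.X_pow_dvd_iff]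
    intro j hj
    rw [map_sub, Polynomial.coeff_coe, arcsinTrunc, finsetSum_coeff]
    simp only [coeff_C_mul_X_pow]
    cases j with
    | zero => simp
    | succ j =>
      rw [PowerSeries.coeff_succ_X_mul, coeff_CSeries, sub_eq_zero]
      simp only [Nat.add_right_cancel_iff]
      rw [Finset.sum_ite_eq, if_pos (Finset.mem_range.2 (by omega))]
  have h4 : (D : PowerSeries ℂ) - PowerSeries.X * (CSeries * (Q : PowerSeries ℂ)) =
      ((D - arcsinTrunc K * Q : ℂ[X]) : PowerSeries ℂ) +
        ((arcsinTrunc K : PowerSeries ℂ) - PowerSeries.X * CSeries) * (Q : PowerSeries ℂ) := by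
    rw [Polynomial.coe_sub, Polynomial.coe_mul]; ring
  rw [h1, dvd_add_left h2, h4, dvd_add_left (h3.mul_right _), X_pow_dvd_aeval_deltaSeries,
    PowerSeries.X_pow_dvd_iff, Polynomial.X_pow_dvd_iff]
  simp only [Polynomial.coeff_coe]

end Symbols

/-! ### Order conditions and truncation errors -/

section Truncation

open Polynomial CompactFD

/-- The `k`-th order condition of a pair of formulas. -/
noncomputable def moment (d s : Formula) (k : ℕ) : ℂ :=
  (d.sum fun j c => c * (j : ℂ) ^ k) +
    (k : ℂ) * ((k : ℂ) - 1) * (s.sum fun j c => c * (j : ℂ) ^ (k - 2))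

lemma coeff_symb (b : Formula) (k : ℕ) : PowerSeries.coeff k (symb b) =
    (b.sum fun j c => c * (j : ℂ) ^ k) / k.factorial := by
  rw [symb, Finsupp.linearCombination_apply, Finsupp.sum, map_sum, Finsupp.sum, Finset.sum_div]
  refine Finset.sum_congr rfl fun j _ => ?_
  rw [map_smul, coeff_expSeries, smul_eq_mul, mul_div_assoc]

lemma coeff_symb_add (d s : Formula) (k : ℕ) :
    PowerSeries.coeff k (symb d + PowerSeries.X ^ 2 * symb s) = moment d s k / k.factorial := by
  rw [map_add, coeff_symb, moment, add_div]
  congr 1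
  rw [PowerSeries.coeff_X_pow_mul']
  split_ifs with hk
  · obtain ⟨j, rfl⟩ := Nat.exists_eq_add_of_le' hk
    rw [coeff_symb, Nat.add_sub_cancel, Nat.factorial_succ, Nat.factorial_succ]
    have h0 : ((j.factorial : ℕ) : ℂ) ≠ 0 := by exact_mod_cast j.factorial_ne_zero
    have h1 : ((j : ℂ) + 1) ≠ 0 := by exact_mod_cast Nat.succ_ne_zero j
    have h2 : ((j : ℂ) + 1 + 1) ≠ 0 := by exact_mod_cast Nat.succ_ne_zero (j + 1)
    push_cast
    field_simp
    ring
  · interval_cases k <;> simp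

lemma X_pow_dvd_symb_iff_moment (d s : Formula) (n : ℕ) :
    (PowerSeries.X : PowerSeries ℂ) ^ n ∣ symb d + PowerSeries.X ^ 2 * symb s ↔
      ∀ k < n, moment d s k = 0 := by
  rw [PowerSeries.X_pow_dvd_iff]
  refine forall₂_congr fun k _ => ?_
  have h0 : ((k.factorial : ℕ) : ℂ) ≠ 0 := by exact_mod_cast k.factorial_ne_zero
  rw [coeff_symb_add, div_eq_zero_iff, or_iff_left h0]

/-- The expression `∑_j d_j u(a + j h) + h² s_j u''(a + j h)`. -/
noncomputable def truncError (d s : Formula) (u : ℝ → ℂ) (a h : ℝ) : ℂ :=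
  (d.sum fun j c => c * u (a + j * h)) +
    (h : ℂ) ^ 2 * (s.sum fun j c => c * iteratedDeriv 2 u (a + j * h))

/-- The Taylor polynomial of `u` at `a`, with `n` terms, as a function of the increment. -/
noncomputable def taylorSum (u : ℝ → ℂ) (n : ℕ) (a y : ℝ) : ℂ :=
  ∑ k ∈ Finset.range n, iteratedDeriv k u a * (y : ℂ) ^ k / k.factorial

lemma contDiff_deriv {u : ℝ → ℂ} (hu : ContDiff ℝ ((⊤ : ℕ∞) : WithTop ℕ∞) u) :
    ContDiff ℝ ((⊤ : ℕ∞) : WithTop ℕ∞) (deriv u) :=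
  (contDiff_infty_iff_deriv.1 hu).2

lemma contDiff_iteratedDeriv {u : ℝ → ℂ} (hu : ContDiff ℝ ((⊤ : ℕ∞) : WithTop ℕ∞) u) (n : ℕ) :
    ContDiff ℝ ((⊤ : ℕ∞) : WithTop ℕ∞) (iteratedDeriv n u) := by
  induction n with
  | zero => simpa using hu
  | succ n ih => rw [iteratedDeriv_succ]; exact contDiff_deriv ih

lemma hasDerivAt_ofReal_pow (k : ℕ) (x : ℝ) :
    HasDerivAt (fun y : ℝ => (y : ℂ) ^ k) ((k : ℂ) * (x : ℂ) ^ (k - 1)) x :=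
  (hasDerivAt_pow k (x : ℂ)).comp_ofReal

lemma hasDerivAt_taylorSum (u : ℝ → ℂ) (n : ℕ) (a y : ℝ) :
    HasDerivAt (fun y => taylorSum u (n + 1) a y) (taylorSum (deriv u) n a y) y := by
  have h : ∀ k ∈ Finset.range (n + 1), HasDerivAt
      (fun y : ℝ => iteratedDeriv k u a * (y : ℂ) ^ k / k.factorial)
      (iteratedDeriv k u a * ((k : ℂ) * (y : ℂ) ^ (k - 1)) / k.factorial) y := fun k _ =>
    ((hasDerivAt_ofReal_pow k y).const_mul _).div_const _
  have := HasDerivAt.fun_sum h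
  refine this.congr_deriv ?_
  symm
  rw [taylorSum, Finset.sum_range_succ']
  simp only [Nat.cast_zero, zero_mul, mul_zero, zero_div, add_zero]
  refine Finset.sum_congr rfl fun k _ => ?_
  have h0 : ((k.factorial : ℕ) : ℂ) ≠ 0 := by exact_mod_cast k.factorial_ne_zero
  have h1 : ((k : ℂ) + 1) ≠ 0 := by exact_mod_cast Nat.succ_ne_zero k
  rw [← iteratedDeriv_succ', Nat.factorial_succ, Nat.add_sub_cancel]
  push_cast
  field_simp

/-- Taylor's formula with a remainder that is uniform in the base point. -/
lemma taylorSum_bound {u : ℝ → ℂ} (hu : ContDiff ℝ ((⊤ : ℕ∞) : WithTop ℕ∞) u) (n : ℕ) (B : ℝ) :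
    ∃ C : ℝ, 0 ≤ C ∧ ∀ a ∈ Set.Icc (-B) B, ∀ y : ℝ, a + y ∈ Set.Icc (-B) B →
      ‖u (a + y) - taylorSum u n a y‖ ≤ C * |y| ^ n := by
  induction n generalizing u with
  | zero =>
    obtain ⟨C, hC⟩ := isCompact_Icc.exists_bound_of_continuousOn
      (hu.continuous.continuousOn (s := Set.Icc (-B) B))
    refine ⟨|C|, abs_nonneg C, fun a _ y hy => ?_⟩
    simpa [taylorSum] using (hC _ hy).trans (le_abs_self C)
  | succ n ih =>
    obtain ⟨C, hC0, hC⟩ := ih (contDiff_deriv hu)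
    refine ⟨C, hC0, fun a ha y hy => ?_⟩
    have hder : ∀ z ∈ Set.uIcc 0 y, HasDerivWithinAt
        (fun z => u (a + z) - taylorSum u (n + 1) a z)
        (deriv u (a + z) - taylorSum (deriv u) n a z) (Set.uIcc 0 y) z := fun z _ => by
      have h1 : HasDerivAt u (deriv u (a + z)) (a + z) :=
        ((hu.differentiable (by simp)) _).hasDerivAt
      exact ((h1.comp_const_add a z).sub (hasDerivAt_taylorSum u n a z)).hasDerivWithinAt
    have hbd : ∀ z ∈ Set.uIcc 0 y, ‖deriv u (a + z) - taylorSum (deriv u) n a z‖ ≤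
        C * |y| ^ n := fun z hz => by
      have hz1 : a + z ∈ Set.Icc (-B) B := by
        rcases Set.mem_uIcc.1 hz with h | h
        · exact ⟨by linarith [ha.1, h.1], by linarith [hy.2, h.2]⟩
        · exact ⟨by linarith [hy.1, h.1], by linarith [ha.2, h.2]⟩
      have hz2 : |z| ≤ |y| := by
        simpa using Set.abs_sub_left_of_mem_uIcc hz
      exact (hC a ha z hz1).trans (by gcongr)
    have := (convex_uIcc 0 y).norm_image_sub_le_of_norm_hasDerivWithin_le hder hbd
      Set.left_mem_uIcc Set.right_mem_uIcc
    have h0 : taylorSum u (n + 1) a 0 = u a := by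
      rw [taylorSum, Finset.sum_range_succ', Finset.sum_eq_zero]
      · simp
      · intro k _; simp
    simpa [h0, pow_succ, mul_assoc] using this

lemma sum_taylorSum (d s : Formula) (u : ℝ → ℂ) (n : ℕ) (a h : ℝ) :
    (d.sum fun j c => c * taylorSum u (n + 2) a (j * h)) +
      (h : ℂ) ^ 2 * (s.sum fun j c => c * taylorSum (iteratedDeriv 2 u) n a (j * h)) =
    ∑ k ∈ Finset.range (n + 2), iteratedDeriv k u a * (h : ℂ) ^ k / k.factorial * moment d s k := by
  have h1 : ∀ (b : Formula) (v : ℝ → ℂ) (n : ℕ), (b.sum fun j c => c * taylorSum v n a (j * h)) =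
      ∑ k ∈ Finset.range n, iteratedDeriv k v a * (h : ℂ) ^ k / k.factorial *
        (b.sum fun j c => c * (j : ℂ) ^ k) := by
    intro b v n
    simp only [Finsupp.sum, taylorSum, Finset.mul_sum]
    rw [Finset.sum_comm]
    refine Finset.sum_congr rfl fun k _ => Finset.sum_congr rfl fun j _ => ?_
    push_cast
    ring
  rw [h1, h1]
  simp only [moment, mul_add, Finset.sum_add_distrib]
  congr 1
  rw [Finset.sum_range_succ', Finset.sum_range_succ', Finset.mul_sum]
  simp only [Nat.cast_zero, zero_mul, mul_zero, add_zero, zero_add, Nat.cast_one, sub_self]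
  refine Finset.sum_congr rfl fun k _ => ?_
  have h0 : ((k.factorial : ℕ) : ℂ) ≠ 0 := by exact_mod_cast k.factorial_ne_zero
  have h2 : ((k : ℂ) + 1) ≠ 0 := by exact_mod_cast Nat.succ_ne_zero k
  have h3 : ((k : ℂ) + 1 + 1) ≠ 0 := by exact_mod_cast Nat.succ_ne_zero (k + 1)
  have h4 : iteratedDeriv k (iteratedDeriv 2 u) a = iteratedDeriv (k + 1 + 1) u a := by
    rw [iteratedDeriv_succ', iteratedDeriv_succ', iteratedDeriv_succ', iteratedDeriv_succ',
      iteratedDeriv_zero]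
  rw [h4, Nat.factorial_succ, Nat.factorial_succ, show k + 1 + 1 - 2 = k by omega]
  push_cast
  field_simp
  ring

lemma sum_remainder_bound {u : ℝ → ℂ} (hu : ContDiff ℝ ((⊤ : ℕ∞) : WithTop ℕ∞) u) (b : Formula)
    (n : ℕ) (A : ℝ) : ∃ C : ℝ, 0 ≤ C ∧ ∀ a ∈ Set.Icc (-A) A, ∀ h ∈ Set.Icc (0 : ℝ) 1,
      ‖(b.sum fun j c => c * u (a + j * h)) - b.sum fun j c => c * taylorSum u n a (j * h)‖ ≤
        C * h ^ n := by
  set J : ℝ := ∑ j ∈ b.support, |(j : ℝ)| with hJ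
  obtain ⟨C, hC0, hC⟩ := taylorSum_bound hu n (A + J)
  have hJj : ∀ j ∈ b.support, |(j : ℝ)| ≤ J := fun j hj =>
    Finset.single_le_sum (f := fun j : ℤ => |(j : ℝ)|) (fun i _ => abs_nonneg _) hj
  refine ⟨∑ j ∈ b.support, ‖b j‖ * (C * |(j : ℝ)| ^ n), by positivity, fun a ha h hh => ?_⟩
  simp only [Finsupp.sum]
  rw [← Finset.sum_sub_distrib, Finset.sum_mul]
  refine (norm_sum_le _ _).trans (Finset.sum_le_sum fun j hj => ?_)
  rw [← mul_sub, norm_mul, mul_assoc]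
  gcongr
  have hJ0 : 0 ≤ J := (abs_nonneg _).trans (hJj j hj)
  have h1 : |(j : ℝ) * h| ≤ J := by
    rw [abs_mul, abs_of_nonneg hh.1]
    exact (mul_le_of_le_one_right (abs_nonneg _) hh.2).trans (hJj j hj)
  have h2 := abs_le.1 h1
  refine (hC a ⟨by linarith [ha.1], by linarith [ha.2]⟩ (j * h)
    ⟨by linarith [ha.1], by linarith [ha.2]⟩).trans (le_of_eq ?_)
  rw [abs_mul, abs_of_nonneg hh.1, mul_pow, mul_assoc]

/-- The constant is uniform in the base point, as needed for all interior rows at once. The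
alternative in the hypothesis also serves the boundary, where the zeroth condition may fail but `u`
vanishes at the base point. -/
lemma truncError_bound {u : ℝ → ℂ} (hu : ContDiff ℝ ((⊤ : ℕ∞) : WithTop ℕ∞) u) (d s : Formula)
    (n : ℕ) (A : ℝ) : ∃ C : ℝ, 0 ≤ C ∧ ∀ a ∈ Set.Icc (-A) A, ∀ h ∈ Set.Icc (0 : ℝ) 1,
      (∀ k < n + 2, iteratedDeriv k u a = 0 ∨ moment d s k = 0) →
        ‖truncError d s u a h‖ ≤ C * h ^ (n + 2) := by
  obtain ⟨C₁, h₁, hC₁⟩ := sum_remainder_bound hu d (n + 2) A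
  obtain ⟨C₂, h₂, hC₂⟩ := sum_remainder_bound (contDiff_iteratedDeriv hu 2) s n A
  refine ⟨C₁ + C₂, by positivity, fun a ha h hh hm => ?_⟩
  have hz := sum_taylorSum d s u n a h
  rw [Finset.sum_eq_zero (fun k hk => by
    rcases hm k (Finset.mem_range.1 hk) with h | h <;> rw [h] <;> simp)] at hz
  have hE : truncError d s u a h =
      ((d.sum fun j c => c * u (a + j * h)) - d.sum fun j c => c * taylorSum u (n + 2) a (j * h)) +
      (h : ℂ) ^ 2 * ((s.sum fun j c => c * iteratedDeriv 2 u (a + j * h)) -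
        s.sum fun j c => c * taylorSum (iteratedDeriv 2 u) n a (j * h)) := by
    rw [truncError]
    linear_combination hz
  rw [hE]
  refine (norm_add_le _ _).trans ?_
  rw [norm_mul, norm_pow, Complex.norm_real, Real.norm_of_nonneg hh.1, add_mul]
  refine add_le_add (hC₁ a ha h hh) ?_
  have := mul_le_mul_of_nonneg_left (hC₂ a ha h hh) (pow_nonneg hh.1 2)
  refine this.trans (le_of_eq (by ring))

lemma step_pos (N : ℕ) : 0 < step N := by rw [step]; positivity

lemma step_le_one (N : ℕ) : step N ≤ 1 := by
  rw [step, div_le_one (by positivity)]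
  have : (0 : ℝ) ≤ N := Nat.cast_nonneg N
  linarith

lemma step_mem (N : ℕ) : step N ∈ Set.Icc (0 : ℝ) 1 := ⟨(step_pos N).le, step_le_one N⟩

lemma tendsto_step : Filter.Tendsto step Filter.atTop (nhds 0) :=
  tendsto_one_div_add_atTop_nhds_zero_nat

lemma iteratedDeriv_two_ofReal_pow (k : ℕ) (x : ℝ) :
    iteratedDeriv 2 (fun y : ℝ => (y : ℂ) ^ k) x = (k : ℂ) * ((k : ℂ) - 1) * (x : ℂ) ^ (k - 2) := by
  rw [iteratedDeriv_succ, iteratedDeriv_one,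
    show deriv (fun y : ℝ => (y : ℂ) ^ k) = fun x : ℝ => (k : ℂ) * (x : ℂ) ^ (k - 1) from
      funext fun x => (hasDerivAt_ofReal_pow k x).deriv,
    ((hasDerivAt_ofReal_pow (k - 1) x).const_mul (k : ℂ)).deriv]
  rcases k with _ | k
  · simp
  · rw [show k + 1 - 1 = k by omega, show k + 1 - 2 = k - 1 by omega]
    push_cast
    ring

lemma contDiff_ofReal_pow (k : ℕ) :
    ContDiff ℝ ((⊤ : ℕ∞) : WithTop ℕ∞) (fun y : ℝ => (y : ℂ) ^ k) :=
  Complex.ofRealCLM.contDiff.pow k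

lemma eq_zero_of_step_isBigO {M : ℂ} {k n : ℕ} (hk : k < n)
    (h : (fun N : ℕ => ((step N : ℝ) : ℂ) ^ k * M) =O[Filter.atTop] fun N => step N ^ n) :
    M = 0 := by
  obtain ⟨C, hC⟩ := h.bound
  have h1 : ∀ᶠ N in Filter.atTop, ‖M‖ ≤ C * step N ^ (n - k) := by
    filter_upwards [hC] with N hN
    have hs := step_pos N
    rw [norm_mul, norm_pow, Complex.norm_real, norm_pow, Real.norm_of_nonneg hs.le,
      show n = (n - k) + k by omega, pow_add] at hN
    have hp : 0 < step N ^ k := by positivity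
    refine le_of_mul_le_mul_left ?_ hp
    linarith
  have h2 : Filter.Tendsto (fun N => C * step N ^ (n - k)) Filter.atTop (nhds 0) := by
    have := (tendsto_step.pow (n - k)).const_mul C
    rwa [zero_pow (by omega), mul_zero] at this
  exact norm_le_zero_iff.1 (ge_of_tendsto h2 h1)

/-- For necessity, test on the monomial of degree k: the expression is then exactly the k-th moment
times h^k. -/
lemma consistentFormula_iff (d s : Formula) (n : ℕ) :
    ConsistentFormula d s n ↔ ∀ k < n + 2, moment d s k = 0 := by
  constructor
  · intro h k hk
    refine eq_zero_of_step_isBigO hk ?_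
    refine (h _ (contDiff_ofReal_pow k)).congr_left fun N => ?_
    simp only [iteratedDeriv_two_ofReal_pow, gridPt, moment, Finsupp.sum, Finset.mul_sum, mul_add]
    congr 1
    · refine Finset.sum_congr rfl fun j _ => ?_
      push_cast; ring
    · refine Finset.sum_congr rfl fun j _ => ?_
      rcases Nat.lt_or_ge k 2 with hk2 | hk2
      · interval_cases k <;> simp
      · obtain ⟨i, rfl⟩ := Nat.exists_eq_add_of_le' hk2
        rw [Nat.add_sub_cancel]
        push_cast
        ring
  · intro h u hu
    obtain ⟨C, -, hC⟩ := truncError_bound hu d s n 0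
    refine Asymptotics.IsBigO.of_bound C (Filter.Eventually.of_forall fun N => ?_)
    have := hC 0 (by simp) (step N) (step_mem N) fun k hk => Or.inr (h k hk)
    rw [norm_pow, Real.norm_of_nonneg (step_pos N).le]
    simpa only [truncError, zero_add, gridPt] using this

end Truncation

/-! ### Strong stability -/

section Stability

open Polynomial CompactFD

/-- The operator `w ↦ (2 w_i - w_(i-1) - w_(i+1))_i` on sequences. -/
noncomputable def seqDelta : Module.End ℂ (ℤ → ℂ) where
  toFun w i := 2 * w i - w (i - 1) - w (i + 1)
  map_add' v w := by ext i; simp only [Pi.add_apply]; ring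
  map_smul' a w := by ext i; simp only [Pi.smul_apply, smul_eq_mul, RingHom.id_apply]; ring

lemma seqDelta_apply (w : ℤ → ℂ) (i : ℤ) :
    seqDelta w i = 2 * w i - w (i - 1) - w (i + 1) := rfl

lemma conv_eq_linearCombination (d : Formula) (w : ℤ → ℂ) (i : ℤ) :
    conv d w i = Finsupp.linearCombination ℂ (fun k : ℤ => w (i - k)) d := rfl

lemma conv_shiftFormula (a : ℤ) (b : Formula) (w : ℤ → ℂ) (i : ℤ) :
    conv (shiftFormula a b) w i = conv b w (i - a) := by
  rw [conv_eq_linearCombination, conv_eq_linearCombination, shiftFormula,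
    Finsupp.lmapDomain_apply, Finsupp.linearCombination_mapDomain]
  congr 2
  funext k
  simp only [Function.comp_apply]
  congr 1
  ring

lemma conv_deltaFormula (b : Formula) (w : ℤ → ℂ) :
    conv (deltaFormula b) w = seqDelta (conv b w) := by
  ext i
  rw [deltaFormula_apply', seqDelta_apply, conv_eq_linearCombination, map_sub, map_sub, map_smul,
    ← conv_eq_linearCombination, ← conv_eq_linearCombination, ← conv_eq_linearCombination,
    conv_shiftFormula, conv_shiftFormula, smul_eq_mul, sub_neg_eq_add]

lemma conv_ofPoly (P : ℂ[X]) (w : ℤ → ℂ) : conv (ofPoly P) w = aeval seqDelta P w := by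
  induction P using ofPoly_induction with
  | hC a =>
    ext i
    rw [ofPoly_C, aeval_C, Module.algebraMap_end_apply, conv, Finsupp.sum_single_index (by simp)]
    simp
  | hadd P Q hP hQ =>
    ext i
    rw [map_add, map_add, LinearMap.add_apply, Pi.add_apply, ← hP, ← hQ,
      conv_eq_linearCombination, map_add]
    rfl
  | hX P h => rw [ofPoly_X_mul, conv_deltaFormula, h, map_mul, aeval_X, Module.End.mul_apply]

/-- Sequences that are odd about `0` and about `N + 1`. -/
structure OddPeriodic (N : ℕ) (w : ℤ → ℂ) : Prop where
  odd : ∀ i, w (-i) = -w i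
  periodic : Function.Periodic w (2 * (N : ℤ) + 2)

lemma OddPeriodic.seqDelta {N : ℕ} {w : ℤ → ℂ} (hw : OddPeriodic N w) :
    OddPeriodic N (seqDelta w) where
  odd i := by
    rw [seqDelta_apply, seqDelta_apply, show -i - 1 = -(i + 1) by ring,
      show -i + 1 = -(i - 1) by ring, hw.odd, hw.odd, hw.odd]
    ring
  periodic i := by
    rw [seqDelta_apply, seqDelta_apply, show i + (2 * (N : ℤ) + 2) - 1 =
      i - 1 + (2 * (N : ℤ) + 2) by ring, show i + (2 * (N : ℤ) + 2) + 1 =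
      i + 1 + (2 * (N : ℤ) + 2) by ring, hw.periodic, hw.periodic, hw.periodic]

lemma OddPeriodic.aeval {N : ℕ} {w : ℤ → ℂ} (hw : OddPeriodic N w) (P : ℂ[X]) :
    OddPeriodic N (aeval _root_.seqDelta P w) := by
  induction P using ofPoly_induction with
  | hC a =>
    rw [aeval_C, Module.algebraMap_end_apply]
    exact ⟨fun i => by simp [hw.odd i], fun i => by simp [hw.periodic i]⟩
  | hadd P Q hP hQ =>
    rw [map_add, LinearMap.add_apply]
    refine ⟨fun i => ?_, fun i => ?_⟩
    · simp only [Pi.add_apply, hP.odd i, hQ.odd i]; ring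
    · simp only [Pi.add_apply, hP.periodic i, hQ.periodic i]
  | hX P h => rw [map_mul, aeval_X, Module.End.mul_apply]; exact h.seqDelta

lemma OddPeriodic.zero {N : ℕ} {w : ℤ → ℂ} (hw : OddPeriodic N w) : w 0 = 0 := by
  have := hw.odd 0
  rw [neg_zero] at this
  linear_combination (1 / 2 : ℂ) * this

lemma OddPeriodic.reflect {N : ℕ} {w : ℤ → ℂ} (hw : OddPeriodic N w) (i : ℤ) :
    w (2 * N + 2 - i) = -w i := by
  rw [← hw.odd, ← hw.periodic (-i)]
  congr 1
  ring

lemma OddPeriodic.right {N : ℕ} {w : ℤ → ℂ} (hw : OddPeriodic N w) : w (N + 1) = 0 := by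
  have := hw.reflect (N + 1)
  rw [show 2 * (N : ℤ) + 2 - (N + 1) = N + 1 by ring] at this
  linear_combination (1 / 2 : ℂ) * this

lemma OddPeriodic.norm_le {N : ℕ} {w : ℤ → ℂ} (hw : OddPeriodic N w) {M : ℝ} (hM : 0 ≤ M)
    (h : ∀ j : ℕ, 1 ≤ j → j ≤ N → ‖w j‖ ≤ M) (i : ℤ) : ‖w i‖ ≤ M := by
  have hsmall : ∀ r : ℤ, 0 ≤ r → r ≤ N + 1 → ‖w r‖ ≤ M := by
    intro r h0 h1
    rcases h0.eq_or_lt with rfl | h0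
    · rw [hw.zero, norm_zero]; exact hM
    rcases h1.eq_or_lt with rfl | h1
    · rw [hw.right, norm_zero]; exact hM
    · lift r to ℕ using h0.le
      exact h r (by omega) (by omega)
  have hper : w i = w (i % (2 * (N : ℤ) + 2)) := by
    have := hw.periodic.int_mul (i / (2 * (N : ℤ) + 2)) (i % (2 * (N : ℤ) + 2))
    rw [← this]
    congr 1
    have := Int.emod_add_mul_ediv i (2 * (N : ℤ) + 2)
    rw [Int.cast_id]
    linarith
  rw [hper]
  have h0 := Int.emod_nonneg i (show (2 * (N : ℤ) + 2) ≠ 0 by omega)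
  have h1 := Int.emod_lt_of_pos i (show 0 < (2 * (N : ℤ) + 2) by omega)
  set r := i % (2 * (N : ℤ) + 2)
  rcases le_or_gt r (N + 1) with hr | hr
  · exact hsmall r h0 hr
  · have := hw.reflect r
    rw [← norm_neg, ← this]
    exact hsmall _ (by omega) (by omega)

/-- The term with `a` is absorbed into the supremum of ‖w‖. The bound `B` only ensures that this
supremum is finite and does not enter the estimate. -/
lemma norm_le_of_sub_shift {w : ℤ → ℂ} {B : ℝ} (hB : ∀ i, ‖w i‖ ≤ B) {a : ℂ} (ha : ‖a‖ < 1)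
    (e : ℤ → ℤ) {M : ℝ} (h : ∀ i, ‖w i - a * w (e i)‖ ≤ M) (i : ℤ) :
    ‖w i‖ ≤ M / (1 - ‖a‖) := by
  have hbdd : BddAbove (Set.range fun i => ‖w i‖) := ⟨B, by rintro _ ⟨i, rfl⟩; exact hB i⟩
  have hsup : (⨆ i, ‖w i‖) ≤ M + ‖a‖ * ⨆ i, ‖w i‖ := by
    refine ciSup_le fun i => ?_
    calc ‖w i‖ = ‖(w i - a * w (e i)) + a * w (e i)‖ := by rw [sub_add_cancel]
      _ ≤ ‖w i - a * w (e i)‖ + ‖a‖ * ‖w (e i)‖ := by rw [← norm_mul]; exact norm_add_le _ _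
      _ ≤ M + ‖a‖ * ⨆ i, ‖w i‖ := by
        gcongr
        · exact h i
        · exact le_ciSup hbdd (e i)
  refine (le_ciSup hbdd i).trans ?_
  rw [le_div_iff₀ (by linarith)]
  linarith

/-- The two roots have product 1. A root z on the unit circle would give r = 2 - 2 Re z, a point of
[0, 4]. -/
lemma exists_small_root {r : ℂ} (hr : ∀ x ∈ Set.Icc (0 : ℝ) 4, r ≠ x) :
    ∃ a : ℂ, ‖a‖ < 1 ∧ a ^ 2 - (2 - r) * a + 1 = 0 := by
  obtain ⟨s, hs⟩ := IsAlgClosed.exists_pow_nat_eq ((2 - r) ^ 2 - 4) (n := 2) (by norm_num)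
  set z := ((2 - r) + s) / 2 with hz
  have hz0 : z ^ 2 - (2 - r) * z + 1 = 0 := by rw [hz]; linear_combination (1 / 4 : ℂ) * hs
  have hzne : z ≠ 0 := by rintro h; rw [h] at hz0; norm_num at hz0
  rcases lt_trichotomy ‖z‖ 1 with h | h | h
  · exact ⟨z, h, hz0⟩
  · exfalso
    have hconj : z * (starRingEnd ℂ) z = 1 := by
      rw [Complex.mul_conj, Complex.normSq_eq_norm_sq, h]; norm_num
    have h2 : r = ((2 - 2 * z.re : ℝ) : ℂ) := by
      have h3 := Complex.add_conj z
      push_cast at h3 ⊢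
      have h4 : z * (r - 2 + (z + (starRingEnd ℂ) z)) = 0 := by
        linear_combination hz0 + hconj
      have h5 := (mul_eq_zero.1 h4).resolve_left hzne
      linear_combination h5 - h3
    have h3 := abs_le.1 (Complex.abs_re_le_norm z)
    rw [h] at h3
    exact hr _ ⟨by linarith [h3.2], by linarith [h3.1]⟩ h2
  · refine ⟨z⁻¹, by rw [norm_inv]; exact inv_lt_one_of_one_lt₀ h, ?_⟩
    field_simp
    linear_combination hz0

/-- With E the shift w ↦ w_(i+1), the equation of `a` gives a(Δ - r) = (1 - a E⁻¹)(1 - a E), and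
each factor is inverted on bounded sequences at the cost 1/(1 - |a|). -/
lemma seqDelta_sub_bound {r : ℂ} (hr : ∀ x ∈ Set.Icc (0 : ℝ) 4, r ≠ x) :
    ∃ C : ℝ, 0 < C ∧ ∀ (w : ℤ → ℂ) (B M : ℝ), (∀ i, ‖w i‖ ≤ B) →
      (∀ i, ‖seqDelta w i - r * w i‖ ≤ M) → ∀ i, ‖w i‖ ≤ C * M := by
  obtain ⟨a, ha, hra⟩ := exists_small_root hr
  have h1 : 0 < 1 - ‖a‖ := by linarith
  refine ⟨1 / (1 - ‖a‖) ^ 2, by positivity, fun w B M hB hM i => ?_⟩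
  have hM0 : 0 ≤ M := (norm_nonneg _).trans (hM 0)
  set y : ℤ → ℂ := fun i => w i - a * w (i + 1) with hy
  have hyB : ∀ i, ‖y i‖ ≤ B + ‖a‖ * B := fun i => by
    refine (norm_sub_le _ _).trans ?_
    rw [norm_mul]
    gcongr
    · exact hB i
    · exact hB (i + 1)
  have hyM : ∀ i, ‖y i - a * y (i - 1)‖ ≤ M := fun i => by
    have : y i - a * y (i - 1) = a * (seqDelta w i - r * w i) := by
      simp only [hy, seqDelta_apply, sub_add_cancel]
      linear_combination (w i) * hra
    rw [this, norm_mul]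
    calc ‖a‖ * ‖seqDelta w i - r * w i‖ ≤ 1 * M := by
          gcongr
          exact hM i
      _ = M := one_mul M
  have h2 := norm_le_of_sub_shift hyB ha (fun i => i - 1) hyM
  have h3 := norm_le_of_sub_shift hB ha (fun i => i + 1) h2 i
  refine h3.trans (le_of_eq ?_)
  field_simp

/-- A polynomial without zeros in the spectrum `[0, 4]` gives an operator bounded from below. -/
lemma aeval_seqDelta_bound {R : ℂ[X]} (hR : ∀ x ∈ Set.Icc (0 : ℝ) 4, R.eval (x : ℂ) ≠ 0) :
    ∃ C : ℝ, 0 < C ∧ ∀ (w : ℤ → ℂ) (B M : ℝ), (∀ i, ‖w i‖ ≤ B) →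
      (∀ i, ‖aeval seqDelta R w i‖ ≤ M) → ∀ i, ‖w i‖ ≤ C * M := by
  induction hn : R.natDegree generalizing R with
  | zero =>
    obtain ⟨a, rfl⟩ := natDegree_eq_zero.1 hn
    have ha : a ≠ 0 := by simpa using hR 0 (by norm_num)
    refine ⟨‖a‖⁻¹, by positivity, fun w B M _ hM i => ?_⟩
    have := hM i
    rw [aeval_C, Module.algebraMap_end_apply, Pi.smul_apply, norm_smul] at this
    rw [inv_mul_eq_div, le_div_iff₀ (by positivity)]
    linarith
  | succ n ih =>
    obtain ⟨r, hr⟩ := IsAlgClosed.exists_root R (by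
      rw [degree_eq_natDegree (by rintro rfl; simp at hn), hn]
      exact_mod_cast Nat.succ_ne_zero n)
    obtain ⟨R₁, rfl⟩ := dvd_iff_isRoot.2 hr
    have hR₁0 : R₁ ≠ 0 := by rintro rfl; simp at hn
    rw [natDegree_mul (X_sub_C_ne_zero r) hR₁0, natDegree_X_sub_C] at hn
    have hfac : ∀ x ∈ Set.Icc (0 : ℝ) 4, (x : ℂ) - r ≠ 0 ∧ R₁.eval (x : ℂ) ≠ 0 := fun x hx => by
      have := hR x hx
      rw [eval_mul, eval_sub, eval_X, eval_C] at this
      exact mul_ne_zero_iff.1 this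
    obtain ⟨C₁, h₁, hC₁⟩ := ih (fun x hx => (hfac x hx).2) (by omega)
    obtain ⟨C₂, h₂, hC₂⟩ := seqDelta_sub_bound (r := r) fun x hx h => (hfac x hx).1 (by
      rw [h, sub_self])
    refine ⟨C₂ * C₁, by positivity, fun w B M hB hM i => ?_⟩
    rw [mul_assoc]
    refine hC₂ w B _ hB (fun i => ?_) i
    refine hC₁ (fun i => seqDelta w i - r * w i) (4 * B + ‖r‖ * B) M (fun i => ?_) (fun i => ?_) i
    · refine (norm_sub_le _ _).trans (add_le_add ?_ ?_)
      · rw [seqDelta_apply]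
        refine (norm_sub_le _ _).trans ?_
        have h3 := norm_sub_le (2 * w i) (w (i - 1))
        rw [norm_mul, Complex.norm_ofNat] at h3
        linarith [hB i, hB (i - 1), hB (i + 1)]
      · rw [norm_mul]
        gcongr
        exact hB i
    · have := hM i
      rw [mul_comm, map_mul, Module.End.mul_apply, map_sub, aeval_X, aeval_C,
        LinearMap.sub_apply, Module.algebraMap_end_apply] at this
      exact this

/-- The discrete maximum principle. -/
lemma discrete_max_principle {n : ℕ} {e : ℕ → ℝ} (h0 : e 0 ≤ 0) (hn : e (n + 1) ≤ 0)
    (h : ∀ j < n, 2 * e (j + 1) ≤ e j + e (j + 2)) {j : ℕ} (hj : j ≤ n + 1) : e j ≤ 0 := by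
  -- Convexity and e 0 ≤ 0 make e j / j nondecreasing; the sign at the right end then propagates
  -- downwards.
  have key : ∀ j ≤ n, ((j : ℝ) + 1) * e j ≤ j * e (j + 1) := by
    intro j hj
    induction j with
    | zero => simpa using h0
    | succ j ih =>
      have h1 := ih (by omega)
      have h2 := mul_le_mul_of_nonneg_left (h j (by omega)) (by positivity : (0 : ℝ) ≤ (j : ℝ) + 1)
      push_cast
      linarith
  induction hj using Nat.decreasingInduction with
  | self => exact hn
  | of_succ j hj ih =>
    have h1 := key j (by omega)
    have h2 : (j : ℝ) * e (j + 1) ≤ 0 := mul_nonpos_of_nonneg_of_nonpos (Nat.cast_nonneg j) ih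
    by_contra hcon
    have : 0 < ((j : ℝ) + 1) * e j := mul_pos (by positivity) (not_le.1 hcon)
    linarith

/-- A barrier function for the discrete Laplacian. -/
noncomputable def barrier (k N : ℕ) (x : ℝ) : ℝ :=
  step N ^ 2 * (x * (N + 1 - x) / 2) +
    ∑ p ∈ Finset.range k, (min x (p + 1) + min (N + 1 - x) (p + 1))

lemma min_concave (x p : ℝ) : min (x - 1) p + min (x + 1) p ≤ 2 * min x p := by
  rcases le_total x p with h | h
  · rw [min_eq_left h]
    linarith [min_le_left (x - 1) p, min_le_left (x + 1) p]
  · rw [min_eq_right h]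
    linarith [min_le_right (x - 1) p, min_le_right (x + 1) p]

lemma min_concave_self (x : ℝ) : 2 * min x x - min (x - 1) x - min (x + 1) x = 1 := by
  rw [min_self, min_eq_left (by linarith), min_eq_right (by linarith)]
  ring

lemma barrier_concave (k N : ℕ) (x : ℝ) :
    2 * barrier k N x - barrier k N (x - 1) - barrier k N (x + 1) = step N ^ 2 +
      ∑ p ∈ Finset.range k, ((2 * min x (p + 1) - min (x - 1) (p + 1) - min (x + 1) (p + 1)) +
        (2 * min (N + 1 - x) (p + 1) - min (N + 1 - x - 1) (p + 1)
          - min (N + 1 - x + 1) (p + 1))) := by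
  simp only [barrier, Finset.sum_add_distrib, Finset.sum_sub_distrib, ← Finset.mul_sum]
  rw [show (N : ℝ) + 1 - (x - 1) = N + 1 - x + 1 by ring,
    show (N : ℝ) + 1 - (x + 1) = N + 1 - x - 1 by ring]
  ring

/-- The parabola contributes h² everywhere. Each min(x, p+1) is concave with a unit kink at p+1, and
its mirror image at N-p; together they cover the k rows nearest to each end. -/
lemma barrier_ge {k N j : ℕ} (hj : 1 ≤ j) (hjN : j ≤ N) :
    (if k < j ∧ j + k < N + 1 then step N ^ 2 else 1) ≤
      2 * barrier k N j - barrier k N (j - 1) - barrier k N (j + 1) := by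
  rw [barrier_concave]
  have hnn : ∀ p ∈ Finset.range k, 0 ≤ (2 * min (j : ℝ) (p + 1) - min ((j : ℝ) - 1) (p + 1) -
      min ((j : ℝ) + 1) (p + 1)) + (2 * min ((N : ℝ) + 1 - j) (p + 1) -
        min ((N : ℝ) + 1 - j - 1) (p + 1) - min ((N : ℝ) + 1 - j + 1) (p + 1)) := fun p _ => by
    linarith [min_concave (j : ℝ) (p + 1), min_concave ((N : ℝ) + 1 - j) (p + 1)]
  split_ifs with h
  · linarith [Finset.sum_nonneg hnn]
  · have hone : ∃ p ∈ Finset.range k, 1 ≤ (2 * min (j : ℝ) (p + 1) - min ((j : ℝ) - 1) (p + 1) -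
      min ((j : ℝ) + 1) (p + 1)) + (2 * min ((N : ℝ) + 1 - j) (p + 1) -
        min ((N : ℝ) + 1 - j - 1) (p + 1) - min ((N : ℝ) + 1 - j + 1) (p + 1)) := by
      rcases (show j ≤ k ∨ N + 1 ≤ j + k by omega) with h | h
      · refine ⟨j - 1, Finset.mem_range.2 (by omega), ?_⟩
        have hc : ((j - 1 : ℕ) : ℝ) + 1 = j := by exact_mod_cast Nat.sub_add_cancel hj
        rw [hc]
        linarith [min_concave_self (j : ℝ), min_concave ((N : ℝ) + 1 - j) j]
      · refine ⟨N - j, Finset.mem_range.2 (by omega), ?_⟩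
        have hc : ((N - j : ℕ) : ℝ) + 1 = N + 1 - j := by rw [Nat.cast_sub hjN]; ring
        rw [hc]
        linarith [min_concave_self ((N : ℝ) + 1 - j), min_concave (j : ℝ) (N + 1 - j)]
    obtain ⟨p, hp, hp1⟩ := hone
    have := Finset.single_le_sum hnn hp
    linarith [sq_nonneg (step N)]

lemma barrier_nonneg (k N : ℕ) {x : ℝ} (h0 : 0 ≤ x) (h1 : x ≤ N + 1) : 0 ≤ barrier k N x := by
  have h2 : 0 ≤ (N : ℝ) + 1 - x := by linarith
  refine add_nonneg (by positivity) (Finset.sum_nonneg fun p _ => add_nonneg ?_ ?_)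
  · exact le_min h0 (by positivity)
  · exact le_min h2 (by positivity)

lemma barrier_le (k N : ℕ) {x : ℝ} (h0 : 0 ≤ x) (h1 : x ≤ N + 1) :
    barrier k N x ≤ 1 + 2 * (k : ℝ) ^ 2 := by
  refine add_le_add ?_ ?_
  · have hN : (0 : ℝ) < N + 1 := by positivity
    rw [step, div_pow, one_pow, one_div, inv_mul_le_iff₀ (by positivity), mul_one]
    nlinarith
  · have : ∀ p ∈ Finset.range k, min x ((p : ℝ) + 1) + min (N + 1 - x) ((p : ℝ) + 1) ≤ 2 * k := by
      intro p hp
      have hp' : (p : ℝ) + 1 ≤ k := by exact_mod_cast Finset.mem_range.1 hp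
      linarith [min_le_right x ((p : ℝ) + 1), min_le_right ((N : ℝ) + 1 - x) ((p : ℝ) + 1)]
    refine (Finset.sum_le_card_nsmul _ _ _ this).trans (le_of_eq ?_)
    rw [Finset.card_range, nsmul_eq_mul]
    ring

/-- By the triangle inequality, the second difference of ‖w‖ is at least -‖Δw‖, so ‖w‖ - W ·
`barrier` is convex and nonpositive at both ends; the maximum principle applies. -/
lemma seqDelta_stable (k N : ℕ) {w : ℤ → ℂ} (hw : OddPeriodic N w) {W : ℝ} (hW : 0 ≤ W)
    (h : ∀ j : ℕ, 1 ≤ j → j ≤ N →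
      ‖seqDelta w j‖ ≤ W * (if k < j ∧ j + k < N + 1 then step N ^ 2 else 1))
    {j : ℕ} (hj : j ≤ N + 1) : ‖w j‖ ≤ W * (1 + 2 * (k : ℝ) ^ 2) := by
  have hb : ∀ j : ℕ, j ≤ N + 1 → (j : ℝ) ≤ N + 1 := fun j hj => by exact_mod_cast hj
  have key := discrete_max_principle (n := N) (e := fun j => ‖w j‖ - W * barrier k N j)
    (by
      have := barrier_nonneg k N le_rfl (by positivity : (0 : ℝ) ≤ N + 1)
      simp only [Nat.cast_zero, hw.zero, norm_zero]
      nlinarith)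
    (by
      have := barrier_nonneg k N (by positivity : (0 : ℝ) ≤ N + 1) le_rfl
      push_cast
      rw [hw.right, norm_zero]
      nlinarith)
    (fun i hi => by
      have h1 := h (i + 1) (by omega) (by omega)
      have h2 := mul_le_mul_of_nonneg_left (barrier_ge (k := k) (N := N) (j := i + 1) (by omega)
        (by omega)) hW
      have h3 : 2 * ‖w ((i + 1 : ℕ) : ℤ)‖ ≤ ‖w (i : ℤ)‖ + ‖w ((i + 2 : ℕ) : ℤ)‖ +
          ‖seqDelta w ((i + 1 : ℕ) : ℤ)‖ := by
        have h4 : 2 * w ((i + 1 : ℕ) : ℤ) = w (i : ℤ) + w ((i + 2 : ℕ) : ℤ) +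
            seqDelta w ((i + 1 : ℕ) : ℤ) := by
          rw [seqDelta_apply]
          push_cast
          rw [add_sub_cancel_right, show (i : ℤ) + 1 + 1 = i + 2 by ring]
          ring
        have h5 := congrArg norm h4
        rw [norm_mul, Complex.norm_ofNat] at h5
        rw [h5]
        exact norm_add₃_le
      push_cast at h1 h2 h3 ⊢
      rw [add_sub_cancel_right, show (i : ℝ) + 1 + 1 = i + 2 by ring] at h2
      linarith) hj
  have h1 := mul_le_mul_of_nonneg_left (barrier_le k N (Nat.cast_nonneg j) (hb j hj)) hW
  have h2 : ‖w j‖ - W * barrier k N j ≤ 0 := key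
  linarith

/-- The extension of a vector to a sequence that is odd about `0` and about `N + 1`. -/
noncomputable def oddExt {N : ℕ} (v : Fin N → ℂ) : ℤ → ℂ := fun i =>
  ∑ j : Fin N, oddPeriodicBasis N (idx j) i * v j

lemma oddPeriodic_basis (N : ℕ) (j : ℤ) : OddPeriodic N (oddPeriodicBasis N j) where
  odd i := by
    simp only [oddPeriodicBasis]
    rw [show -i - j = -(i + j) by ring, show -i + j = -(i - j) by ring]
    simp only [dvd_neg]
    ring
  periodic i := by
    simp only [oddPeriodicBasis]
    rw [show i + (2 * (N : ℤ) + 2) - j = i - j + (2 * (N : ℤ) + 2) by ring,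
      show i + (2 * (N : ℤ) + 2) + j = i + j + (2 * (N : ℤ) + 2) by ring]
    simp only [dvd_add_self_right]

lemma oddPeriodic_oddExt {N : ℕ} (v : Fin N → ℂ) : OddPeriodic N (oddExt v) where
  odd i := by
    simp only [oddExt, (oddPeriodic_basis N _).odd i, neg_mul, Finset.sum_neg_distrib]
  periodic i := by
    simp only [oddExt, (oddPeriodic_basis N _).periodic i]

lemma oddExt_idx {N : ℕ} (v : Fin N → ℂ) (i : Fin N) : oddExt v (idx i) = v i := by
  rw [oddExt, Finset.sum_eq_single i]
  · have : ¬ (2 * (N : ℤ) + 2) ∣ (idx i : ℤ) + idx i := by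
      intro h
      have := Int.le_of_dvd (by simp only [idx]; push_cast; omega) h
      have := i.2
      simp only [idx] at *
      push_cast at *
      omega
    simp [oddPeriodicBasis, this]
  · intro j _ hj
    have hi := i.2
    have hj' := j.2
    have hne : (i : ℕ) ≠ j := fun h => hj (Fin.ext h.symm)
    have h1 : ¬ (2 * (N : ℤ) + 2) ∣ (idx i : ℤ) + idx j := by
      intro h
      have := Int.le_of_dvd (by simp only [idx]; push_cast; omega) h
      simp only [idx] at *
      push_cast at *
      omega
    have h2 : ¬ (2 * (N : ℤ) + 2) ∣ (idx i : ℤ) - idx j := by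
      intro h
      have := Int.eq_zero_of_abs_lt_dvd h (by
        rw [abs_lt]; simp only [idx]; push_cast; constructor <;> omega)
      simp only [idx] at this
      push_cast at this
      omega
    simp [oddPeriodicBasis, h1, h2]
  · simp

lemma DMat_mulVec (d : Formula) {N : ℕ} (v : Fin N → ℂ) (i : Fin N) :
    (DMat d N).mulVec v i = conv d (oddExt v) (idx i) := by
  simp only [Matrix.mulVec, dotProduct, DMat, Matrix.of_apply, conv, oddExt, Finsupp.sum,
    Finset.mul_sum, Finset.sum_mul]
  rw [Finset.sum_comm]
  simp only [mul_assoc]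

/-- On odd periodic extensions the matrix is Δ R(Δ). The barrier argument bounds u = R(Δ)v in the
weighted norm, and the lower bound for R(Δ), which is free of N and insensitive to the boundary,
passes from u to v. -/
theorem stronglyStable_ofPoly {R : ℂ[X]} (hR : ∀ x ∈ Set.Icc (0 : ℝ) 4, R.eval (x : ℂ) ≠ 0) :
    StronglyStable (DMat (ofPoly (X * R))) := by
  obtain ⟨C, hC, hCb⟩ := aeval_seqDelta_bound hR
  intro k
  have hk : (0 : ℝ) < 1 + 2 * (k : ℝ) ^ 2 := by positivity
  refine ⟨(C * (1 + 2 * (k : ℝ) ^ 2))⁻¹, by positivity, fun N hN v => ?_⟩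
  set g := (DMat (ofPoly (X * R)) N).mulVec v with hg
  set F : Fin N → ℝ := fun j => if k < idx j ∧ idx j + k < N + 1 then (step N)⁻¹ ^ 2 * ‖g j‖
    else ‖g j‖ with hF
  have hs := step_pos N
  have hFle : ∀ j, F j ≤ ⨆ j, F j := le_ciSup (Set.finite_range F).bddAbove
  have hF0 : ∀ j, 0 ≤ F j := fun j => by simp only [hF]; split_ifs <;> positivity
  set W := ⨆ j, F j with hW
  have hW0 : 0 ≤ W := (hF0 ⟨0, hN⟩).trans (hFle _)
  have hw := oddPeriodic_oddExt v
  set u := aeval seqDelta R (oddExt v) with hu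
  have hδ : ∀ j : ℕ, 1 ≤ j → j ≤ N →
      ‖seqDelta u j‖ ≤ W * (if k < j ∧ j + k < N + 1 then step N ^ 2 else 1) := by
    intro j h1 h2
    have hj := hFle ⟨j - 1, by omega⟩
    have hidx : idx (⟨j - 1, by omega⟩ : Fin N) = j := Nat.sub_add_cancel h1
    have hgj : g ⟨j - 1, by omega⟩ = seqDelta u j := by
      rw [hg, DMat_mulVec, hidx, conv_ofPoly, map_mul, aeval_X, Module.End.mul_apply]
    simp only [hF, hidx, hgj] at hj
    split_ifs at hj ⊢ with hc
    · rw [inv_pow, inv_mul_le_iff₀ (by positivity)] at hj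
      linarith
    · linarith
  have hub : ∀ i, ‖u i‖ ≤ W * (1 + 2 * (k : ℝ) ^ 2) := (hw.aeval R).norm_le (by positivity)
    fun j _ h2 => seqDelta_stable k N (hw.aeval R) hW0 hδ (by omega)
  have hvB := hw.norm_le (norm_nonneg v) fun j h1 h2 => by
    have hidx : idx (⟨j - 1, by omega⟩ : Fin N) = j := Nat.sub_add_cancel h1
    rw [← hidx, oddExt_idx]
    exact norm_le_pi_norm v _
  have hfin := hCb _ _ _ hvB hub
  rw [inv_mul_le_iff₀ (by positivity), pi_norm_le_iff_of_nonneg (by positivity)]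
  intro i
  have := hfin (idx i)
  rw [oddExt_idx] at this
  linarith

lemma CompactFD.StronglyStable.isUnit {D : (N : ℕ) → Matrix (Fin N) (Fin N) ℂ} (hD : StronglyStable D)
    {N : ℕ} (hN : 1 ≤ N) : IsUnit (D N) := by
  obtain ⟨c, hc, h⟩ := hD 0
  rw [← Matrix.mulVec_injective_iff_isUnit]
  refine (injective_iff_map_eq_zero (Matrix.mulVecLin (D N))).2 fun v hv => ?_
  have h1 := h N hN v
  rw [Matrix.mulVecLin_apply] at hv
  rw [hv] at h1
  simp only [Pi.zero_apply, norm_zero, mul_zero, ite_self, Real.iSup_const_zero] at h1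
  have h2 : ‖v‖ ≤ 0 := by
    by_contra hcon
    have := mul_pos hc (not_le.1 hcon)
    linarith
  exact norm_le_zero_iff.1 h2

end Stability

/-! ### Optimal formulas and Padé pairs -/

section Optimal

open Polynomial CompactFD

lemma consistentFormula_ofPoly_iff (D Q : ℂ[X]) (n : ℕ) :
    ConsistentFormula (ofPoly D) (ofPoly Q) (2 * n) ↔
      (PowerSeries.X : PowerSeries ℂ) ^ (n + 1) ∣
        (D : PowerSeries ℂ) - PowerSeries.X * (CSeries * (Q : PowerSeries ℂ)) := by
  rw [consistentFormula_iff, ← X_pow_dvd_symb_iff_moment, show 2 * n + 2 = 2 * (n + 1) by ring,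
    X_pow_dvd_symb_iff]

lemma X_mul_approx_iff (R Q : ℂ[X]) (n : ℕ) :
    (PowerSeries.X : PowerSeries ℂ) ^ (n + 1) ∣ ((X * R : ℂ[X]) : PowerSeries ℂ) -
        PowerSeries.X * (CSeries * (Q : PowerSeries ℂ)) ↔
      (PowerSeries.X : PowerSeries ℂ) ^ n ∣ (R : PowerSeries ℂ) - CSeries * (Q : PowerSeries ℂ) := by
  rw [Polynomial.coe_mul, Polynomial.coe_X, ← mul_sub, pow_succ',
    mul_dvd_mul_iff_left PowerSeries.X_ne_zero]

/-- Any consistency forces D(0) = 0, so a factor X splits off; this is why `d` is allowed the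
stencil l + 1 for a numerator of degree l. -/
lemma CompactFD.Admissible.exists_poly {l m : ℕ} {d s : Formula} (h : Admissible l m d s) {n : ℕ}
    (hc : ConsistentFormula d s (2 * n)) : ∃ R Q : ℂ[X], d = ofPoly (X * R) ∧ s = ofPoly Q ∧
      (R, Q) ≠ (0, 0) ∧ R.natDegree ≤ l ∧ Q.natDegree ≤ m ∧
      (PowerSeries.X : PowerSeries ℂ) ^ n ∣
        (R : PowerSeries ℂ) - CSeries * (Q : PowerSeries ℂ) := by
  obtain ⟨D, hD, rfl⟩ := exists_ofPoly h.symm_d (k := l + 1) (by exact_mod_cast h.stencil_d)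
  obtain ⟨Q, hQ, rfl⟩ := exists_ofPoly h.symm_s h.stencil_s
  rw [consistentFormula_ofPoly_iff] at hc
  have h0 : D.coeff 0 = 0 := by
    have := PowerSeries.X_pow_dvd_iff.1 hc 0 (by omega)
    simpa using this
  obtain ⟨R, rfl⟩ := X_dvd_iff.2 h0
  refine ⟨R, Q, rfl, rfl, ?_, ?_, hQ, (X_mul_approx_iff R Q n).1 hc⟩
  · intro hRQ
    obtain ⟨rfl, rfl⟩ := Prod.mk.inj hRQ
    exact h.ne_zero (by simp)
  · by_cases hR : R = 0
    · simp [hR]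
    · rw [natDegree_X_mul hR] at hD
      omega

lemma CompactFD.Admissible.not_consistent {l m : ℕ} {d s : Formula} (h : Admissible l m d s)
    {n : ℕ} (hn : l + m + 1 < n) : ¬ ConsistentFormula d s (2 * n) := by
  intro hc
  obtain ⟨R, Q, -, -, hne, hR, hQ, hd⟩ := h.exists_poly hc
  have hP : IsPadePair l m R Q := ⟨hne, hR, hQ, (pow_dvd_pow _ (by omega)).trans hd⟩
  exact hP.not_dvd ((pow_dvd_pow _ (by omega)).trans hd)

lemma CompactFD.Admissible.ord_le {l m : ℕ} {d s : Formula} (h : Admissible l m d s) :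
    ord d s ≤ ((2 * (l + m + 1) : ℕ) : ℕ∞) := by
  refine iSup₂_le fun n hn => ?_
  obtain ⟨k, rfl⟩ := even_iff_two_dvd.1 hn.1
  have : ¬ l + m + 1 < k := fun hk => h.not_consistent hk hn.2
  exact_mod_cast (by omega : 2 * k ≤ 2 * (l + m + 1))

/-- Read off the coefficient of t² in δ R(δ), where δ = -t² + …. The normalization of optimal
formulas is thus R(0) = 1, possible because R(0) ≠ 0. -/
lemma sum_mul_sq_ofPoly (R : ℂ[X]) :
    ((ofPoly (X * R)).sum fun j c => c * (j : ℂ) ^ 2) = -2 * R.eval 0 := by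
  have h := coeff_symb (ofPoly (X * R)) 2
  obtain ⟨v, hv, hv0⟩ := exists_deltaSeries_eq
  have h1 : PowerSeries.coeff 2 (symb (ofPoly (X * R))) = -R.eval 0 := by
    rw [symb_ofPoly, map_mul, aeval_X]
    have hR : PowerSeries.constantCoeff (aeval deltaSeries R) = R.eval 0 := by
      rw [← R.divX_mul_X_add, map_add, map_mul, aeval_X, aeval_C]
      nth_rewrite 2 [hv]
      simp
    set A := aeval deltaSeries R
    rw [hv, mul_assoc, PowerSeries.coeff_X_pow_mul', if_pos le_rfl, Nat.sub_self,
      PowerSeries.coeff_zero_eq_constantCoeff_apply, map_mul, hv0, hR]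
    ring
  rw [h1, eq_div_iff (by norm_num)] at h
  rw [← h]
  norm_num
  ring

lemma CompactFD.IsPadePair.smul {l m : ℕ} {R Q : ℂ[X]} (h : IsPadePair l m R Q) {a : ℂ}
    (ha : a ≠ 0) : IsPadePair l m (C a * R) (C a * Q) := by
  refine ⟨fun h0 => h.ne_zero ?_, (natDegree_C_mul_le _ _).trans h.deg_num,
    (natDegree_C_mul_le _ _).trans h.deg_den, ?_⟩
  · simpa [ha] using h0
  · rw [Polynomial.coe_mul, Polynomial.coe_mul, mul_left_comm, ← mul_sub]
    exact h.approx.mul_left _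

lemma exists_normalized_padePair (l m : ℕ) :
    ∃ R Q : ℂ[X], IsPadePair l m R Q ∧ R.eval 0 = 1 := by
  obtain ⟨R, Q, h⟩ := exists_isPadePair l m
  have h0 : R.eval 0 ≠ 0 := by simpa using h.eval_ne_zero (x := 0) (by norm_num)
  refine ⟨_, _, h.smul (inv_ne_zero h0), ?_⟩
  rw [eval_mul, eval_C, inv_mul_cancel₀ h0]

lemma CompactFD.IsPadePair.consistent {l m : ℕ} {R Q : ℂ[X]} (h : IsPadePair l m R Q) :
    ConsistentFormula (ofPoly (X * R)) (ofPoly Q) (2 * (l + m + 1)) :=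
  (consistentFormula_ofPoly_iff _ _ _).2 ((X_mul_approx_iff R Q _).2 h.approx)

lemma CompactFD.IsPadePair.admissible {l m : ℕ} {R Q : ℂ[X]} (h : IsPadePair l m R Q) :
    Admissible l m (ofPoly (X * R)) (ofPoly Q) where
  symm_d := isSymm_ofPoly _
  symm_s := isSymm_ofPoly _
  ne_zero h0 := by
    have h1 := sum_mul_sq_ofPoly R
    rw [(Prod.mk.inj h0).1, Finsupp.sum_zero_index] at h1
    have h2 : R.eval 0 ≠ 0 := by simpa using h.eval_ne_zero (x := 0) (by norm_num)
    simp_all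
  stencil_d := by
    have := stencilLE_ofPoly (P := X * R) (k := l + 1)
      (natDegree_mul_le.trans (by have := h.deg_num; rw [natDegree_X]; omega))
    exact_mod_cast this
  stencil_s := stencilLE_ofPoly h.deg_den

lemma CompactFD.IsPadePair.le_ord {l m : ℕ} {R Q : ℂ[X]} (h : IsPadePair l m R Q) :
    ((2 * (l + m + 1) : ℕ) : ℕ∞) ≤ ord (ofPoly (X * R)) (ofPoly Q) :=
  le_iSup₂_of_le (2 * (l + m + 1)) ⟨even_two_mul _, h.consistent⟩ le_rfl

theorem exists_isOptimal (l m : ℕ) : ∃ d s : Formula, IsOptimal l m d s := by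
  obtain ⟨R, Q, h, h1⟩ := exists_normalized_padePair l m
  exact ⟨ofPoly (X * R), ofPoly Q, h.admissible, by rw [sum_mul_sq_ofPoly, h1, mul_one],
    fun d' s' h' => h'.ord_le.trans h.le_ord⟩

theorem CompactFD.IsOptimal.exists_padePair {l m : ℕ} {d s : Formula} (h : IsOptimal l m d s) :
    ConsistentFormula d s (2 * (l + m + 1)) ∧
      ∃ R Q : ℂ[X], d = ofPoly (X * R) ∧ s = ofPoly Q ∧ IsPadePair l m R Q := by
  obtain ⟨R₀, Q₀, h₀⟩ := exists_isPadePair l m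
  have hord := h₀.le_ord.trans (h.maximal _ _ h₀.admissible)
  have hc : ConsistentFormula d s (2 * (l + m + 1)) := by
    by_contra hcon
    -- Only even orders count, so missing 2(l+m+1) costs two orders and contradicts comparison with
    -- a Padé pair.
    have hle : ord d s ≤ ((2 * (l + m) : ℕ) : ℕ∞) := by
      refine iSup₂_le fun n hn => ?_
      obtain ⟨k, rfl⟩ := even_iff_two_dvd.1 hn.1
      have : ¬ l + m + 1 ≤ k := fun hk => hcon (by
        rw [consistentFormula_iff] at hn ⊢
        exact fun j hj => hn.2 j (by omega))
      exact_mod_cast (by omega : 2 * k ≤ 2 * (l + m))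
    have := hord.trans hle
    have h2 : 2 * (l + m + 1) ≤ 2 * (l + m) := by exact_mod_cast this
    omega
  obtain ⟨R, Q, hd, hs, hne, hR, hQ, happ⟩ := h.admissible.exists_poly hc
  exact ⟨hc, R, Q, hd, hs, hne, hR, hQ, happ⟩

theorem CompactFD.IsOptimal.stronglyStable {l m : ℕ} {d s : Formula} (h : IsOptimal l m d s) :
    StronglyStable (DMat d) := by
  obtain ⟨-, R, Q, rfl, -, hP⟩ := h.exists_padePair
  exact stronglyStable_ofPoly fun x hx => hP.eval_ne_zero hx

end Optimal

/-! ### Boundary corrections -/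

section Boundary

open Polynomial CompactFD

/-- The odd sequence that agrees with `g` at the positive integers. -/
noncomputable def oddVal (g : ℤ → ℂ) (k : ℤ) : ℂ :=
  if 0 < k then g k else if k < 0 then -g (-k) else 0

/-- The pairing of a formula with a sequence. -/
noncomputable def pairing (g : ℤ → ℂ) : Formula →ₗ[ℂ] ℂ := Finsupp.linearCombination ℂ g

lemma pairing_apply (g : ℤ → ℂ) (b : Formula) : pairing g b = b.sum fun j c => c * g j := rfl

lemma pairing_equivMapDomain (g : ℤ → ℂ) (e : ℤ ≃ ℤ) (b : Formula) :
    pairing g (b.equivMapDomain e) = pairing (fun j => g (e j)) b := by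
  rw [pairing_apply, Finsupp.sum_equivMapDomain, pairing_apply]

lemma pairing_shiftFormula (g : ℤ → ℂ) (a : ℤ) (b : Formula) :
    pairing g (shiftFormula a b) = pairing (fun j => g (j + a)) b := by
  rw [pairing, shiftFormula, Finsupp.lmapDomain_apply, Finsupp.linearCombination_mapDomain]
  rfl

lemma pairing_congr {g g' : ℤ → ℂ} {b : Formula} (h : ∀ j, b j ≠ 0 → g j = g' j) :
    pairing g b = pairing g' b := by
  rw [pairing_apply, pairing_apply]
  exact Finsupp.sum_congr fun j hj => by rw [h j (Finsupp.mem_support_iff.1 hj)]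

lemma pairing_sub_left (g g' : ℤ → ℂ) (b : Formula) :
    pairing g b - pairing g' b = pairing (fun j => g j - g' j) b := by
  simp only [pairing_apply, Finsupp.sum, ← Finset.sum_sub_distrib, mul_sub]

lemma pairing_neg_left (g : ℤ → ℂ) (b : Formula) :
    pairing (fun j => -g j) b = -pairing g b := by
  simp only [pairing_apply, Finsupp.sum, mul_neg, Finset.sum_neg_distrib]

lemma pairing_symm {b : Formula} (hb : IsSymm b) (g : ℤ → ℂ) :
    pairing (fun j => g (-j)) b = pairing g b := by
  have h : b.equivMapDomain (Equiv.neg ℤ) = b := by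
    ext j
    rw [Finsupp.equivMapDomain_apply]
    exact (hb j).symm
  conv_rhs => rw [← h]
  rw [pairing_equivMapDomain]
  rfl

lemma pairing_filter (g : ℤ → ℂ) (p : ℤ → Prop) [DecidablePred p] (b : Formula) :
    pairing g (b.filter p) = pairing (fun j => if p j then g j else 0) b := by
  rw [pairing_apply, Finsupp.sum, Finsupp.support_filter, Finset.sum_filter, pairing_apply,
    Finsupp.sum]
  refine Finset.sum_congr rfl fun j _ => ?_
  split_ifs with h
  · rw [Finsupp.filter_apply_pos p b h]
  · rw [mul_zero]

/-- The boundary formulas `d^i` extend a sequence by oddness. -/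
lemma pairing_boundaryD {d : Formula} (hd : IsSymm d) (i : ℕ) (g : ℤ → ℂ) :
    pairing (fun j => g (j + i)) ((boundaryD d i).filter fun j => -(i : ℤ) < j) =
      pairing (fun j => oddVal g (j + i)) d := by
  rw [pairing_filter, boundaryD, map_sub, pairing_equivMapDomain]
  rw [← pairing_symm hd (fun j => if -(i : ℤ) < Equiv.subRight (2 * (i : ℤ)) j then
    g (Equiv.subRight (2 * (i : ℤ)) j + i) else 0), pairing_sub_left]
  congr 2
  funext j
  simp only [Equiv.subRight_apply, oddVal]
  rcases lt_trichotomy (j + i) 0 with h | h | h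
  · rw [if_neg (by omega), if_pos (by omega), if_neg (by omega), if_pos h, zero_sub]
    congr 2
    ring
  · rw [if_neg (by omega), if_neg (by omega), if_neg (by omega), if_neg (by omega), sub_zero]
  · rw [if_pos (by omega), if_neg (by omega), if_pos h, sub_zero]

lemma pairing_boundaryS (s b : Formula) (i : ℕ) (g : ℤ → ℂ) :
    pairing (fun j => g (j + i)) (boundaryS s b i) =
      pairing (fun j => g (j + i)) s + pairing g b := by
  rw [boundaryS, map_add, pairing_equivMapDomain]
  simp

lemma moment_eq (d s : Formula) (k : ℕ) : moment d s k = pairing (fun j => (j : ℂ) ^ k) d +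
    (k : ℂ) * ((k : ℂ) - 1) * pairing (fun j => (j : ℂ) ^ (k - 2)) s := rfl

lemma truncError_eq (d s : Formula) (u : ℝ → ℂ) (a h : ℝ) :
    truncError d s u a h = pairing (fun j => u (a + j * h)) d +
      (h : ℂ) ^ 2 * pairing (fun j => iteratedDeriv 2 u (a + j * h)) s := rfl

/-- Symmetric formulas with prescribed even moments. -/
lemma exists_isSymm_moments (M : ℕ) (r : ℕ → ℂ) : ∃ b : Formula, IsSymm b ∧
    StencilLE b ((M : ℤ) - 1) ∧ ∀ q < M, pairing (fun j => (j : ℂ) ^ (2 * q)) b = r q := by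
  -- The even moments of a symmetric formula form a Vandermonde system with the distinct nodes k², 0
  -- ≤ k < M. Splitting each unknown in halves at ±k also gives the right weight when k = 0.
  set V : Matrix (Fin M) (Fin M) ℂ := Matrix.vandermonde fun k => ((k : ℕ) : ℂ) ^ 2 with hV
  have hdet : IsUnit V.transpose := by
    rw [Matrix.isUnit_iff_isUnit_det, Matrix.det_transpose, isUnit_iff_ne_zero,
      Matrix.det_vandermonde_ne_zero_iff]
    intro i j hij
    have h1 : ((i : ℕ) : ℂ) ^ 2 = ((j : ℕ) : ℂ) ^ 2 := hij
    have h2 : (i : ℕ) ^ 2 = (j : ℕ) ^ 2 := by exact_mod_cast h1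
    exact Fin.ext (Nat.pow_left_injective (by norm_num) h2)
  obtain ⟨β, hβ⟩ := Matrix.mulVec_surjective_iff_isUnit.2 hdet fun q : Fin M => r q
  refine ⟨∑ k : Fin M, (β k / 2) • (Finsupp.single ((k : ℕ) : ℤ) 1 +
    Finsupp.single (-((k : ℕ) : ℤ)) 1), fun j => ?_, fun j hj => ?_, fun q hq => ?_⟩
  · rw [Finsupp.finsetSum_apply, Finsupp.finsetSum_apply]
    refine Finset.sum_congr rfl fun k _ => ?_
    simp only [Finsupp.smul_apply, Finsupp.add_apply, Finsupp.single_apply, neg_inj]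
    rw [add_comm]
    simp only [show ((k : ℕ) : ℤ) = -j ↔ -((k : ℕ) : ℤ) = j by omega]
  · rw [Finsupp.finsetSum_apply]
    refine Finset.sum_eq_zero fun k _ => ?_
    have hk := k.2
    rw [Finsupp.smul_apply, Finsupp.add_apply, Finsupp.single_eq_of_ne (by omega),
      Finsupp.single_eq_of_ne (by omega), add_zero, smul_zero]
  · rw [map_sum]
    have := congrFun hβ ⟨q, hq⟩
    rw [← this, Matrix.mulVec, dotProduct]
    refine Finset.sum_congr rfl fun k _ => ?_
    rw [map_smul, map_add, pairing, Finsupp.linearCombination_single,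
      Finsupp.linearCombination_single, Matrix.transpose_apply, hV, Matrix.vandermonde_apply]
    push_cast
    rw [Even.neg_pow (even_two_mul q), ← pow_mul]
    simp only [smul_eq_mul]
    ring

lemma pairing_odd_eq_zero {b : Formula} (hb : IsSymm b) {g : ℤ → ℂ} (hg : ∀ j, g (-j) = -g j) :
    pairing g b = 0 := by
  have h := pairing_symm hb g
  simp only [hg] at h
  rw [pairing_neg_left] at h
  linear_combination (-1 / 2 : ℂ) * h

lemma oddVal_pow {k : ℕ} (hk : Odd k) (j : ℤ) :
    oddVal (fun j => (j : ℂ) ^ k) j = (j : ℂ) ^ k := by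
  rw [oddVal]
  split_ifs with h1 h2
  · rfl
  · push_cast
    rw [hk.neg_pow, neg_neg]
  · rw [show j = 0 by omega, Int.cast_zero, zero_pow hk.pos.ne']

lemma moment_shift_eq_zero {d s : Formula} {n : ℕ} (h : ∀ k < n, moment d s k = 0) (a : ℤ) :
    ∀ k < n, moment (shiftFormula a d) (shiftFormula a s) k = 0 := by
  rw [← X_pow_dvd_symb_iff_moment] at h ⊢
  rw [symb_shiftFormula, symb_shiftFormula, mul_left_comm, ← mul_add]
  exact h.mul_left _

/-- Expand at 0, where `u` vanishes, so that the zeroth moment is irrelevant. Odd powers equal their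
own odd extension, so odd moments are those of the shifted interior pair; a symmetric `b` does not
disturb them. The M even moments left determine those of `b`. -/
theorem exists_isBoundaryCorrection {d s : Formula} (hd : IsSymm d) {M : ℕ}
    (hc : ConsistentFormula d s (2 * M)) (i : ℕ) :
    ∃ b : Formula, IsBoundaryCorrection d s (2 * M) i b := by
  rw [consistentFormula_iff] at hc
  -- The order condition k = 2q + 2, solved for the moment of index 2q of `b` after division by k(k
  -- - 1).
  set r : ℕ → ℂ := fun q => -(pairing (fun j => oddVal (fun j => (j : ℂ) ^ (2 * q + 2)) (j + i)) d /
    (((2 * q + 2 : ℕ) : ℂ) * (((2 * q + 2 : ℕ) : ℂ) - 1)) +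
    pairing (fun j => ((j + i : ℤ) : ℂ) ^ (2 * q)) s) with hr
  obtain ⟨b, hb, hbM, hbr⟩ := exists_isSymm_moments M r
  refine ⟨b, hb, by rwa [Nat.mul_div_cancel_left M (by norm_num)], fun u hu hu0 => ?_⟩
  set dB := shiftFormula i ((boundaryD d i).filter fun j => -(i : ℤ) < j) with hdB
  set sB := shiftFormula i (boundaryS s b i) with hsB
  have hpd : ∀ g : ℤ → ℂ, pairing g dB = pairing (fun j => oddVal g (j + i)) d := fun g => by
    rw [hdB, pairing_shiftFormula, pairing_boundaryD hd]
  have hps : ∀ g : ℤ → ℂ, pairing g sB = pairing (fun j => g (j + i)) s + pairing g b := fun g => by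
    rw [hsB, pairing_shiftFormula, pairing_boundaryS]
  have hmom : ∀ k < 2 * M + 2, k ≠ 0 → moment dB sB k = 0 := by
    intro k hk hk0
    rw [moment_eq, hpd, hps]
    rcases Nat.even_or_odd' k with ⟨q, rfl | rfl⟩
    · obtain ⟨q, rfl⟩ := Nat.exists_eq_succ_of_ne_zero (show q ≠ 0 by omega)
      have h1 : (((2 * q + 2 : ℕ) : ℂ) * (((2 * q + 2 : ℕ) : ℂ) - 1)) ≠ 0 := by
        refine mul_ne_zero (Nat.cast_ne_zero.2 (by omega)) ?_
        rw [show ((2 * q + 2 : ℕ) : ℂ) - 1 = ((2 * q + 1 : ℕ) : ℂ) by push_cast; ring]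
        exact Nat.cast_ne_zero.2 (by omega)
      rw [show 2 * q.succ = 2 * q + 2 by omega, Nat.add_sub_cancel, hbr q (by omega), hr]
      have aux : ∀ A B c : ℂ, c ≠ 0 → A + c * (B + -(A / c + B)) = 0 := fun A B c hc => by
        field_simp
        ring
      exact aux _ _ _ h1
    · have hodd : Odd (2 * q + 1) := odd_two_mul_add_one q
      have h2 := moment_shift_eq_zero hc i (2 * q + 1) hk
      rw [moment_eq, pairing_shiftFormula, pairing_shiftFormula] at h2
      simp only [oddVal_pow hodd]
      have h3 : ((2 * q + 1 : ℕ) : ℂ) * (((2 * q + 1 : ℕ) : ℂ) - 1) *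
          pairing (fun j => (j : ℂ) ^ (2 * q + 1 - 2)) b = 0 := by
        rcases q with _ | q
        · simp
        · rw [pairing_odd_eq_zero hb, mul_zero]
          intro j
          push_cast
          rw [show 2 * (q + 1) - 1 = 2 * q + 1 by omega]
          exact (odd_two_mul_add_one q).neg_pow _
      rw [mul_add, h3, add_zero]
      exact h2
  obtain ⟨C, -, hC⟩ := truncError_bound hu dB sB (2 * M) 0
  refine Asymptotics.IsBigO.of_bound C (Filter.Eventually.of_forall fun N => ?_)
  have h := hC 0 (by simp) (step N) (step_mem N) fun k hk => by
    by_cases hk0 : k = 0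
    · left; rw [hk0, iteratedDeriv_zero, hu0]
    · right; exact hmom k hk hk0
  rw [norm_pow, Real.norm_of_nonneg (step_pos N).le]
  rw [truncError_eq, hdB, hsB, pairing_shiftFormula, pairing_shiftFormula] at h
  simp only [zero_add] at h
  exact h

end Boundary

/-! ### Convergence of the associated scheme -/

section Convergence

open Polynomial CompactFD

lemma exists_dirichletSolution {f : ℝ → ℂ} (hf : ContDiff ℝ ((⊤ : ℕ∞) : WithTop ℕ∞) f) :
    ∃ U : ℝ → ℂ, ContDiff ℝ ((⊤ : ℕ∞) : WithTop ℕ∞) U ∧ (∀ x, iteratedDeriv 2 U x = -f x) ∧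
      U 0 = 0 ∧ U 1 = 0 := by
  have hprim : ∀ g : ℝ → ℂ, ContDiff ℝ ((⊤ : ℕ∞) : WithTop ℕ∞) g →
      ∃ G : ℝ → ℂ, ContDiff ℝ ((⊤ : ℕ∞) : WithTop ℕ∞) G ∧ deriv G = g ∧ G 0 = 0 := by
    intro g hg
    have hder : ∀ x, HasDerivAt (fun x => ∫ t in (0 : ℝ)..x, g t) (g x) x := fun x =>
      intervalIntegral.integral_hasDerivAt_right (hg.continuous.intervalIntegrable _ _)
        hg.continuous.aestronglyMeasurable.stronglyMeasurableAtFilter hg.continuous.continuousAt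
    have hd : deriv (fun x => ∫ t in (0 : ℝ)..x, g t) = g := funext fun x => (hder x).deriv
    refine ⟨_, contDiff_infty_iff_deriv.2 ⟨fun x => (hder x).differentiableAt, ?_⟩, hd, by simp⟩
    rw [hd]
    exact hg
  obtain ⟨G, hG, hGd, -⟩ := hprim f hf
  obtain ⟨F, hF, hFd, hF0⟩ := hprim G hG
  have hlin : ∀ x, HasDerivAt (fun x : ℝ => (x : ℂ) * F 1 - F x) (F 1 - G x) x := fun x => by
    have h1 : HasDerivAt (fun x : ℝ => (x : ℂ)) 1 x := Complex.ofRealCLM.hasDerivAt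
    have h2 : HasDerivAt F (G x) x := by
      rw [← hFd]; exact ((hF.differentiable (by simp)) x).hasDerivAt
    simpa using (h1.mul_const (F 1)).fun_sub h2
  refine ⟨fun x => (x : ℂ) * F 1 - F x, ?_, fun x => ?_, by simp [hF0], by simp⟩
  · exact (Complex.ofRealCLM.contDiff.mul contDiff_const).sub hF
  · have h2 : HasDerivAt G (f x) x := by
      rw [← hGd]; exact ((hG.differentiable (by simp)) x).hasDerivAt
    rw [iteratedDeriv_succ, iteratedDeriv_one, show deriv (fun x : ℝ => (x : ℂ) * F 1 - F x) =
      fun x => F 1 - G x from funext fun x => (hlin x).deriv]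
    exact (h2.const_sub (F 1)).deriv

/-- The difference has zero second derivative only in the open interval, so it is affine there;
continuity up to the ends then makes it vanish. -/
lemma dirichletSolution_unique {f u U : ℝ → ℂ} (hu : IsDirichletSolution f u)
    (hU : ContDiff ℝ ((⊤ : ℕ∞) : WithTop ℕ∞) U) (hUf : ∀ x, iteratedDeriv 2 U x = -f x)
    (h0 : U 0 = 0) (h1 : U 1 = 0) : ∀ x ∈ Set.Icc (0 : ℝ) 1, u x = U x := by
  obtain ⟨v, hv⟩ := hu.hasDeriv
  have hU1 : ∀ x, HasDerivAt U (deriv U x) x := fun x =>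
    ((hU.differentiable (by simp)) x).hasDerivAt
  have hU2 : ∀ x, HasDerivAt (deriv U) (-f x) x := fun x => by
    have := (((contDiff_deriv hU).differentiable (by simp)) x).hasDerivAt
    rwa [← iteratedDeriv_one, ← iteratedDeriv_succ, hUf, iteratedDeriv_one] at this
  have hconst : ∀ (p : ℝ → ℂ), (∀ x ∈ Set.Ioo (0 : ℝ) 1, HasDerivAt p 0 x) →
      ∀ x ∈ Set.Ioo (0 : ℝ) 1, p x = p (1 / 2) := fun p hp x hx =>
    isOpen_Ioo.is_const_of_deriv_eq_zero (convex_Ioo _ _).isPreconnected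
      (fun y hy => (hp y hy).differentiableAt.differentiableWithinAt)
      (fun y hy => (hp y hy).deriv) hx (by norm_num)
  have h2 := hconst (fun x => v x - deriv U x) fun x hx => by
    simpa using (hv x hx).2.fun_sub (hU2 x)
  set c := v (1 / 2) - deriv U (1 / 2) with hc
  have h3 := hconst (fun x => u x - U x - (x : ℂ) * c) fun x hx => by
    have h4 : HasDerivAt (fun x : ℝ => (x : ℂ)) 1 x := Complex.ofRealCLM.hasDerivAt
    have h5 := (((hv x hx).1.sub (hU1 x)).sub (h4.mul_const c))
    have h6 : v x - deriv U x = c := h2 x hx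
    rw [h6, one_mul, sub_self] at h5
    exact h5
  set k := u (1 / 2) - U (1 / 2) - ((1 / 2 : ℝ) : ℂ) * c with hk
  have hcont : ContinuousOn (fun x => u x - U x - (x : ℂ) * c) (Set.Icc 0 1) :=
    (hu.continuousOn.sub hU.continuous.continuousOn).sub
      (Complex.continuous_ofReal.mul continuous_const).continuousOn
  have h7 : Set.EqOn (fun x => u x - U x - (x : ℂ) * c) (fun _ => k) (Set.Icc 0 1) :=
    Set.EqOn.of_subset_closure (s := Set.Ioo 0 1) (fun x hx => h3 x hx) hcont continuousOn_const
      Set.Ioo_subset_Icc_self (by rw [closure_Ioo (by norm_num)])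
  have hk0 : k = 0 := by
    have := h7 (Set.left_mem_Icc.2 zero_le_one)
    simp only [hu.left, h0] at this
    simpa using this.symm
  have hc0 : c = 0 := by
    have := h7 (Set.right_mem_Icc.2 zero_le_one)
    simp only [hu.right, h1, hk0] at this
    simpa using this
  intro x hx
  have := h7 hx
  simp only [hc0, hk0, mul_zero, sub_zero] at this
  exact sub_eq_zero.1 this

lemma gridPt_mem {N j : ℕ} (hj : j ≤ N + 1) : gridPt N j ∈ Set.Icc (0 : ℝ) 1 := by
  have h := step_pos N
  have hj' : (j : ℝ) ≤ N + 1 := by exact_mod_cast hj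
  have h1 : ((N : ℝ) + 1) * step N = 1 := by rw [step]; field_simp
  rw [gridPt, Int.cast_natCast]
  exact ⟨by positivity, by rw [← h1]; gcongr⟩

lemma gridPt_right (N : ℕ) : gridPt N ((N : ℤ) + 1) = 1 := by
  rw [gridPt, step]; push_cast; field_simp

lemma gridPt_reflect (N : ℕ) (j : ℤ) : gridPt N (N + 1 - j) = 1 - gridPt N j := by
  rw [← gridPt_right N, gridPt, gridPt, gridPt]; push_cast; ring

lemma gridPt_add (N : ℕ) (i j : ℤ) : gridPt N (j + i) = gridPt N i + j * step N := by
  rw [gridPt, gridPt]; push_cast; ring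

/-- The values of a function at the grid points. -/
noncomputable def gridVec (U : ℝ → ℂ) (N : ℕ) : Fin N → ℂ := fun j => U (gridPt N (idx j))

lemma oddExt_gridVec {U : ℝ → ℂ} (h0 : U 0 = 0) (h1 : U 1 = 0) {N : ℕ} {k : ℤ} (hk0 : 0 ≤ k)
    (hkN : k ≤ N + 1) : oddExt (gridVec U N) k = U (gridPt N k) := by
  rcases hk0.eq_or_lt with rfl | hk0
  · rw [(oddPeriodic_oddExt _).zero, gridPt, Int.cast_zero, zero_mul, h0]
  rcases hkN.eq_or_lt with rfl | hkN
  · rw [(oddPeriodic_oddExt _).right, gridPt_right, h1]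
  · lift k to ℕ using hk0.le
    have hidx : idx (⟨k - 1, by omega⟩ : Fin N) = k := Nat.sub_add_cancel (by omega)
    have := oddExt_idx (gridVec U N) ⟨k - 1, by omega⟩
    rw [hidx] at this
    rw [this, gridVec, hidx]

lemma oddExt_gridVec_eq_oddVal {U : ℝ → ℂ} (h0 : U 0 = 0) (h1 : U 1 = 0) {N : ℕ} {k : ℤ}
    (hk0 : -((N : ℤ) + 1) ≤ k) (hkN : k ≤ N + 1) :
    oddExt (gridVec U N) k = oddVal (fun j => U (gridPt N j)) k := by
  rw [oddVal]
  split_ifs with h2 h3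
  · exact oddExt_gridVec h0 h1 h2.le hkN
  · rw [← oddExt_gridVec h0 h1 (k := -k) (by omega) (by omega), (oddPeriodic_oddExt _).odd, neg_neg]
  · rw [show k = 0 by omega, (oddPeriodic_oddExt _).zero]

lemma conv_eq_pairing (d : Formula) (w : ℤ → ℂ) (i : ℤ) :
    conv d w i = pairing (fun j => w (i - j)) d := rfl

lemma conv_eq_pairing_of_symm {d : Formula} (hd : IsSymm d) (w : ℤ → ℂ) (i : ℤ) :
    conv d w i = pairing (fun j => w (j + i)) d := by
  rw [conv_eq_pairing, ← pairing_symm hd]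
  congr 2
  funext j
  rw [sub_neg_eq_add, add_comm]

lemma abs_le_of_stencil {d : Formula} (hd : IsSymm d) {k : ℤ} (hk : StencilLE d k) {j : ℤ}
    (hj : d j ≠ 0) : -k ≤ j ∧ j ≤ k := by
  constructor
  · by_contra h
    exact hj (by rw [hd j]; exact hk _ (by omega))
  · by_contra h
    exact hj (hk _ (by omega))

lemma SMatrix_app (N : ℕ) (S : SMatrix N) (F : ℤ → ℂ) (i : Fin N) :
    S.app F i = pairing F (S i) := rfl

variable {l : ℕ} {d s : Formula} {f U : ℝ → ℂ}

/-- In these rows a stencil of size l + 1 reaches at most the indices 0 and N + 1, where the odd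
extension and `U` both vanish, so no reflected value is used. -/
lemma residual_interior (hd : IsSymm d) (hdl : StencilLE d ((l : ℤ) + 1))
    (hU2 : ∀ x, iteratedDeriv 2 U x = -f x) (h0 : U 0 = 0) (h1 : U 1 = 0) (b : ℕ → Formula)
    {N : ℕ} (i : Fin N) (hi : l < idx i) (hi' : idx i + l < N + 1) :
    (DMat d N).mulVec (gridVec U N) i -
      ((step N : ℝ) : ℂ) ^ 2 * (SMat l s b N).app (fun j => f (gridPt N j)) i =
    truncError d s U (gridPt N (idx i)) (step N) := by
  rw [DMat_mulVec, conv_eq_pairing_of_symm hd, SMatrix_app, SMat, if_neg (by omega),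
    if_neg (by omega), pairing_equivMapDomain, truncError_eq]
  have hD : pairing (fun j => oddExt (gridVec U N) (j + idx i)) d =
      pairing (fun j => U (gridPt N (idx i) + j * step N)) d := by
    refine pairing_congr fun j hj => ?_
    have := abs_le_of_stencil hd hdl hj
    rw [oddExt_gridVec h0 h1 (by omega) (by omega), gridPt_add]
  have hS : pairing (fun j => iteratedDeriv 2 U (gridPt N (idx i) + j * step N)) s =
      -pairing (fun j => f (gridPt N (Equiv.addRight (idx i : ℤ) j))) s := by
    rw [← pairing_neg_left]
    refine pairing_congr fun j _ => ?_
    rw [hU2, Equiv.coe_addRight, gridPt_add]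
  rw [hD, hS]
  ring

/-- The expression that is small when `b` is a boundary correction. -/
noncomputable def boundaryError (d s b : Formula) (i : ℕ) (u : ℝ → ℂ) (N : ℕ) : ℂ :=
  ((boundaryD d i).filter fun j => -(i : ℤ) < j).sum (fun j c => c * u (gridPt N (j + i))) +
    ((step N : ℝ) : ℂ) ^ 2 *
      ((boundaryS s b i).sum fun j c => c * iteratedDeriv 2 u (gridPt N (j + i)))

lemma boundaryError_eq (hd : IsSymm d) (b : Formula) (i : ℕ) (u : ℝ → ℂ) (N : ℕ) :
    boundaryError d s b i u N = pairing (fun j => oddVal (fun j => u (gridPt N j)) (j + i)) d +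
      ((step N : ℝ) : ℂ) ^ 2 *
        pairing (fun j => iteratedDeriv 2 u (gridPt N (j + i))) (boundaryS s b i) := by
  rw [← pairing_boundaryD hd i (fun j => u (gridPt N j))]
  rfl

lemma residual_left (hd : IsSymm d) (hdl : StencilLE d ((l : ℤ) + 1))
    (hU2 : ∀ x, iteratedDeriv 2 U x = -f x) (h0 : U 0 = 0) (h1 : U 1 = 0) (b : ℕ → Formula)
    {N : ℕ} (hN : 2 * l ≤ N) (i : Fin N) (hi : idx i ≤ l) :
    (DMat d N).mulVec (gridVec U N) i -
      ((step N : ℝ) : ℂ) ^ 2 * (SMat l s b N).app (fun j => f (gridPt N j)) i =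
    boundaryError d s (b (idx i)) (idx i) U N := by
  rw [DMat_mulVec, conv_eq_pairing_of_symm hd, SMatrix_app, SMat, if_pos hi,
    pairing_equivMapDomain, boundaryError_eq hd]
  have hD : pairing (fun j => oddExt (gridVec U N) (j + idx i)) d =
      pairing (fun j => oddVal (fun j => U (gridPt N j)) (j + idx i)) d := by
    refine pairing_congr fun j hj => ?_
    have := abs_le_of_stencil hd hdl hj
    exact oddExt_gridVec_eq_oddVal h0 h1 (by omega) (by omega)
  have hS : pairing (fun j => iteratedDeriv 2 U (gridPt N (j + idx i)))
      (boundaryS s (b (idx i)) (idx i)) =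
      -pairing (fun j => f (gridPt N (Equiv.addRight (idx i : ℤ) j)))
        (boundaryS s (b (idx i)) (idx i)) := by
    rw [← pairing_neg_left]
    refine pairing_congr fun j _ => ?_
    rw [hU2, Equiv.coe_addRight]
  rw [hD, hS]
  ring

/-- The reflection x ↦ 1 - x reduces the right end to the left one; it preserves second derivatives
and, since `d` is symmetric, the matrix row. -/
lemma residual_right (hd : IsSymm d) (hdl : StencilLE d ((l : ℤ) + 1))
    (hU2 : ∀ x, iteratedDeriv 2 U x = -f x) (h0 : U 0 = 0) (h1 : U 1 = 0) (b : ℕ → Formula)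
    {N : ℕ} (hN : 2 * l ≤ N) (i : Fin N) (hi : N + 1 ≤ idx i + l) :
    (DMat d N).mulVec (gridVec U N) i -
      ((step N : ℝ) : ℂ) ^ 2 * (SMat l s b N).app (fun j => f (gridPt N j)) i =
    boundaryError d s (b (N + 1 - idx i)) (N + 1 - idx i) (fun x => U (1 - x)) N := by
  have hiN : idx i ≤ N := i.2
  have hcast : ((N + 1 - idx i : ℕ) : ℤ) = N + 1 - idx i := by
    rw [Nat.cast_sub (by omega)]; push_cast; ring
  rw [DMat_mulVec, conv_eq_pairing, SMatrix_app, SMat, if_neg (by omega), if_pos hi,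
    pairing_equivMapDomain, boundaryError_eq hd]
  have hD : pairing (fun j => oddExt (gridVec U N) (idx i - j)) d =
      pairing (fun j => oddVal (fun j => U (1 - gridPt N j)) (j + (N + 1 - idx i : ℕ))) d := by
    refine pairing_congr fun j hj => ?_
    have := abs_le_of_stencil hd hdl hj
    rw [hcast]
    set k : ℤ := j + (N + 1 - idx i) with hk
    rw [show (idx i : ℤ) - j = N + 1 - k by rw [hk]; ring, oddVal]
    split_ifs with h2 h3
    · rw [oddExt_gridVec h0 h1 (by omega) (by omega), gridPt_reflect]
    · have h4 := (oddPeriodic_oddExt (gridVec U N)).reflect (N + 1 - k)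
      rw [show 2 * (N : ℤ) + 2 - (N + 1 - k) = N + 1 - -k by ring,
        oddExt_gridVec h0 h1 (by omega) (by omega), gridPt_reflect] at h4
      rw [h4, neg_neg]
    · rw [show k = 0 by omega, sub_zero, (oddPeriodic_oddExt _).right]
  have hS : pairing (fun j => iteratedDeriv 2 (fun x => U (1 - x))
        (gridPt N (j + (N + 1 - idx i : ℕ))))
      (boundaryS s (b (N + 1 - idx i)) (N + 1 - idx i)) =
      -pairing (fun j => f (gridPt N (Equiv.subLeft (idx i : ℤ) j)))
        (boundaryS s (b (N + 1 - idx i)) (N + 1 - idx i)) := by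
    rw [← pairing_neg_left]
    refine pairing_congr fun j _ => ?_
    rw [iteratedDeriv_comp_const_sub]
    simp only [hU2, Equiv.subLeft_apply, ← gridPt_reflect, hcast]
    rw [show (N : ℤ) + 1 - (j + (N + 1 - idx i)) = idx i - j by ring]
    simp
  rw [hD, hS]
  ring

lemma eventually_boundaryError {μ : ℕ} {b : ℕ → Formula}
    (hb : ∀ i ∈ Finset.Icc 1 l, IsBoundaryCorrection d s μ i (b i))
    (hU : ContDiff ℝ ((⊤ : ℕ∞) : WithTop ℕ∞) U) (h0 : U 0 = 0) :
    ∃ C : ℝ, 0 ≤ C ∧ ∀ᶠ N in Filter.atTop, ∀ i ∈ Finset.Icc 1 l,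
      ‖boundaryError d s (b i) i U N‖ ≤ C * step N ^ (μ + 2) := by
  have h : ∀ i : ℕ, ∃ C : ℝ, 0 ≤ C ∧ (i ∈ Finset.Icc 1 l → ∀ᶠ N in Filter.atTop,
      ‖boundaryError d s (b i) i U N‖ ≤ C * step N ^ (μ + 2)) := by
    intro i
    by_cases hi : i ∈ Finset.Icc 1 l
    · obtain ⟨C, hC0, hC⟩ := ((hb i hi).consistent U hU h0).exists_nonneg
      refine ⟨C, hC0, fun _ => ?_⟩
      filter_upwards [hC.bound] with N hN
      rw [norm_pow, Real.norm_of_nonneg (step_pos N).le] at hN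
      exact hN
    · exact ⟨0, le_rfl, fun h => absurd h hi⟩
  choose C hC0 hC using h
  refine ⟨∑ i ∈ Finset.Icc 1 l, C i, Finset.sum_nonneg fun i _ => hC0 i, ?_⟩
  rw [Filter.eventually_all_finset]
  intro i hi
  filter_upwards [hC i hi] with N hN
  refine hN.trans ?_
  have := step_pos N
  gcongr
  exact Finset.single_le_sum (fun i _ => hC0 i) hi

/-- Apply strong stability with boundary layers of width l to the error. Interior residuals
O(h^(μ+4)) carry the weight h⁻² and the l rows at each end, only O(h^(μ+2)), carry weight 1. -/
lemma eventually_error_bound {μ : ℕ} {b : ℕ → Formula} (hst : StronglyStable (DMat d))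
    (hd : IsSymm d) (hdl : StencilLE d ((l : ℤ) + 1)) (hc : ConsistentFormula d s (μ + 2))
    (hb : ∀ i ∈ Finset.Icc 1 l, IsBoundaryCorrection d s μ i (b i))
    (hU : ContDiff ℝ ((⊤ : ℕ∞) : WithTop ℕ∞) U)
    (hU2 : ∀ x, iteratedDeriv 2 U x = -f x) (h0 : U 0 = 0) (h1 : U 1 = 0) :
    ∃ C : ℝ, ∀ᶠ N in Filter.atTop, ∀ uN : Fin N → ℂ, (DMat d N).mulVec uN =
      ((step N : ℝ) : ℂ) ^ 2 • (SMat l s b N).app (fun j => f (gridPt N j)) →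
        ‖uN - gridVec U N‖ ≤ C * step N ^ (μ + 2) := by
  obtain ⟨c, hc0, hcb⟩ := hst l
  obtain ⟨C₁, hC₁0, hC₁⟩ := truncError_bound hU d s (μ + 2) 1
  obtain ⟨C₂, hC₂0, hC₂⟩ := eventually_boundaryError hb hU h0
  have hU' : ContDiff ℝ ((⊤ : ℕ∞) : WithTop ℕ∞) (fun x => U (1 - x)) :=
    hU.comp (contDiff_const.sub contDiff_id)
  obtain ⟨C₃, hC₃0, hC₃⟩ := eventually_boundaryError hb hU' (by simpa using h1)
  rw [consistentFormula_iff] at hc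
  refine ⟨c⁻¹ * (C₁ + C₂ + C₃), ?_⟩
  filter_upwards [hC₂, hC₃, Filter.eventually_ge_atTop (2 * l + 1)] with N h2 h3 hN uN huN
  have hs := step_pos N
  have hres : ∀ i, (DMat d N).mulVec (uN - gridVec U N) i =
      -((DMat d N).mulVec (gridVec U N) i -
        ((step N : ℝ) : ℂ) ^ 2 * (SMat l s b N).app (fun j => f (gridPt N j)) i) := fun i => by
    rw [Matrix.mulVec_sub, huN, Pi.sub_apply, Pi.smul_apply, smul_eq_mul]
    ring
  have hpow : 0 < step N ^ (μ + 2) := by positivity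
  have hsum : ∀ C : ℝ, C ≤ C₁ + C₂ + C₃ →
      C * step N ^ (μ + 2) ≤ (C₁ + C₂ + C₃) * step N ^ (μ + 2) := fun C hC =>
    mul_le_mul_of_nonneg_right hC hpow.le
  have : Nonempty (Fin N) := ⟨⟨0, by omega⟩⟩
  have hmain := (hcb N (by omega) (uN - gridVec U N)).trans (ciSup_le (c :=
    (C₁ + C₂ + C₃) * step N ^ (μ + 2)) fun i => ?_)
  · rw [mul_assoc, ← div_eq_inv_mul, le_div_iff₀ hc0]
    linarith
  · rw [hres, norm_neg]
    have hiN : idx i ≤ N := i.2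
    have hi1 : 1 ≤ idx i := Nat.succ_pos _
    split_ifs with hi
    · rw [residual_interior hd hdl hU2 h0 h1 b i hi.1 hi.2, inv_pow,
        inv_mul_le_iff₀ (by positivity)]
      have hg := gridPt_mem (N := N) (j := idx i) (by omega)
      have h4 := hC₁ (gridPt N (idx i)) ⟨by linarith [hg.1], hg.2⟩ (step N) (step_mem N)
        fun k hk => Or.inr (hc k hk)
      refine h4.trans ?_
      have h5 := mul_le_mul_of_nonneg_left (hsum C₁ (by linarith)) (sq_nonneg (step N))
      refine le_trans (le_of_eq ?_) h5
      ring
    · rcases (show idx i ≤ l ∨ N + 1 ≤ idx i + l by omega) with h | h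
      · rw [residual_left hd hdl hU2 h0 h1 b (by omega) i h]
        exact (h2 _ (Finset.mem_Icc.2 ⟨hi1, h⟩)).trans (hsum C₂ (by linarith))
      · rw [residual_right hd hdl hU2 h0 h1 b (by omega) i h]
        exact (h3 _ (Finset.mem_Icc.2 ⟨by omega, by omega⟩)).trans (hsum C₃ (by linarith))

lemma exists_bound_of_eventually {E : ℕ → ℝ} {C : ℝ} {n : ℕ}
    (h : ∀ᶠ N in Filter.atTop, E N ≤ C * step N ^ n) :
    ∃ c : ℝ, 0 < c ∧ ∀ N, E N ≤ c * step N ^ n := by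
  obtain ⟨N₀, hN₀⟩ := Filter.eventually_atTop.1 h
  have hsum : 0 ≤ ∑ N ∈ Finset.range N₀, |E N| / step N ^ n :=
    Finset.sum_nonneg fun N _ => by have := step_pos N; positivity
  refine ⟨1 + |C| + ∑ N ∈ Finset.range N₀, |E N| / step N ^ n, by positivity, fun N => ?_⟩
  have hs : 0 < step N ^ n := pow_pos (step_pos N) n
  rcases le_or_gt N₀ N with hN | hN
  · refine (hN₀ N hN).trans (mul_le_mul_of_nonneg_right ?_ hs.le)
    linarith [le_abs_self C]
  · rw [← div_le_iff₀ hs]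
    have h1 : |E N| / step N ^ n ≤ ∑ N ∈ Finset.range N₀, |E N| / step N ^ n :=
      Finset.single_le_sum (f := fun N => |E N| / step N ^ n)
        (fun N _ => by have := step_pos N; positivity) (Finset.mem_range.2 hN)
    have h2 : E N / step N ^ n ≤ |E N| / step N ^ n := by gcongr; exact le_abs_self _
    linarith [abs_nonneg C]

theorem convergentOfOrder_of_stable {μ : ℕ} {b : ℕ → Formula} {S : (N : ℕ) → SMatrix N}
    (hst : StronglyStable (DMat d)) (hd : IsSymm d) (hdl : StencilLE d ((l : ℤ) + 1))
    (hc : ConsistentFormula d s (μ + 2))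
    (hb : ∀ i ∈ Finset.Icc 1 l, IsBoundaryCorrection d s μ i (b i))
    (hS : ∀ᶠ N in Filter.atTop, S N = SMat l s b N) :
    ConvergentOfOrder (DMat d) S (μ + 2) := by
  refine ⟨fun N hN => hst.isUnit hN, fun f hf => ?_⟩
  obtain ⟨U, hU, hU2, h0, h1⟩ := exists_dirichletSolution hf
  obtain ⟨C, hC⟩ := eventually_error_bound hst hd hdl hc hb hU hU2 h0 h1
  set rhs : (N : ℕ) → Fin N → ℂ := fun N =>
    ((step N : ℝ) : ℂ) ^ 2 • (S N).app (fun j => f (gridPt N j)) with hrhs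
  -- The constant must precede `u` and `uN`. By invertibility the discrete solution is determined by
  -- N, so the error is a sequence in N whose first terms can be absorbed.
  have hev : ∀ᶠ N in Filter.atTop,
      ‖(DMat d N)⁻¹.mulVec (rhs N) - gridVec U N‖ ≤ C * step N ^ (μ + 2) := by
    filter_upwards [hC, hS, Filter.eventually_ge_atTop 1] with N hN hSN hN1
    refine hN _ ?_
    rw [Matrix.mulVec_mulVec, Matrix.mul_nonsing_inv _
      ((Matrix.isUnit_iff_isUnit_det _).1 (hst.isUnit hN1)), Matrix.one_mulVec, hrhs]
    simp only [hSN]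
  obtain ⟨c, hc0, hcb⟩ := exists_bound_of_eventually hev
  refine ⟨c, hc0, fun u hu N hN uN huN j => ?_⟩
  have huN' : uN = (DMat d N)⁻¹.mulVec (rhs N) := by
    rw [hrhs]
    simp only [← huN]
    rw [Matrix.mulVec_mulVec, Matrix.nonsing_inv_mul _
      ((Matrix.isUnit_iff_isUnit_det _).1 (hst.isUnit hN)), Matrix.one_mulVec]
  have hj : idx j ≤ N := j.2
  rw [dirichletSolution_unique hu hU hU2 h0 h1 _ (gridPt_mem (by omega)), huN']
  exact (norm_le_pi_norm ((DMat d N)⁻¹.mulVec (rhs N) - gridVec U N) j).trans (hcb N)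

end Convergence

theorem theorem3 (l m : ℕ) (hl : 1 ≤ l) :
    (∃ d s : CompactFD.Formula, CompactFD.IsOptimal l m d s) ∧
    (∀ d s : CompactFD.Formula, CompactFD.IsOptimal l m d s →
      CompactFD.StronglyStable (CompactFD.DMat d) ∧
      (∃ b : ℕ → CompactFD.Formula,
        ∀ i ∈ Finset.Icc 1 l, CompactFD.IsBoundaryCorrection d s (2 * (l + m)) i (b i)) ∧
      ∀ (b : ℕ → CompactFD.Formula) (S : (N : ℕ) → CompactFD.SMatrix N),
        (∀ i ∈ Finset.Icc 1 l, CompactFD.IsBoundaryCorrection d s (2 * (l + m)) i (b i)) →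
        (∀ᶠ N in Filter.atTop, S N = CompactFD.SMat l s b N) →
        CompactFD.ConvergentOfOrder (CompactFD.DMat d) S (2 * (l + m + 1))) ∧
    (∀ R Q : Polynomial ℂ, CompactFD.IsPadePair l m R Q →
      ∀ x : ℝ, x ∈ Set.Icc (0 : ℝ) 4 → R.eval (x : ℂ) ≠ 0) := by
  refine ⟨exists_isOptimal l m, fun d s h => ?_, fun R Q h x hx => h.eval_ne_zero hx⟩
  have hc := h.exists_padePair.1
  -- Near the boundary only order μ = 2(l+m) is asked for, two less than the pair has.
  have hc' : CompactFD.ConsistentFormula d s (2 * (l + m)) := by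
    rw [consistentFormula_iff] at hc ⊢
    exact fun k hk => hc k (by omega)
  refine ⟨h.stronglyStable, ?_, fun b S hb hS =>
    convergentOfOrder_of_stable h.stronglyStable h.admissible.symm_d h.admissible.stencil_d
      hc hb hS⟩
  choose b hb using fun i => exists_isBoundaryCorrection h.admissible.symm_d hc' i
  exact ⟨b, fun i _ => hb i⟩
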